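/- Let $d\in\mathbb N$ and let $X=\mathbb N_0^{\mathbb Z^d}$ carry the product topology, its Borel $\sigma$-algebra and the coordinatewise order; let $X_f\subset X$ be the (countable) set of configurations $\eta$ with $\sum_x\eta(x)<\infty$. Let $g:\mathbb N_0\to[0,\infty)$ be non-decreasing with $g(0)=0$ and $g(n)\to\infty$, and let $p(x,y)=p(y-x)$, $x,y\in\mathbb Z^d$, be translation-invariant transition probabilities ($p(z)\ge 0$, $\sum_z p(z)=1$). Let $S(t)$, $t\ge 0$, be the semigroup of the zero-range process on $X_f$, i.e. of the Markov process on $X_f$ with generator $$Lf(\eta)=\sum_{x\neq y} g(\eta(x))\,p(x,y)\,\big(f(\eta^{x,y})-f(\eta)\big),$$ where $\eta^{x,y}$ is $\eta$ with one particle moved from $x$ to $y$ (and $\eta^{x,y}=\eta$ if $\eta(x)=0$); on the configurations with a given number of particles $L$ is bounded and $S(t)=e^{tL}$. For a probability measure $\nu$ on $X_f$ let $\nu S(t)$ be the law at time $t$ of this process with initial law $\nu$. For probability measures on $X$ write $\nu\le\nu'$ if $\int f\,d\nu\le\int f\,d\nu'$ for every bounded increasing $f:X\to\mathbb R$ that depends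 on finitely many coordinates; "increasing sequence" refers to this order, and convergence of measures is weak convergence. For a probability measure $\mu$ on $X$ let $[\mu]_n$ be the law, under $\mu$, of the configuration that equals $\eta$ on $[-n,n]^d$ and $0$ outside of it, and write $\mu_t=\lim_{n\to\infty}[\mu]_nS(t)$ whenever this limit exists as a probability measure on $X$. Let $\mu$ be a translation-invariant probability measure on $X$ with $\int\eta(0)\,d\mu(\eta)<\infty$. Then for every $t\ge 0$ the sequence $([\mu]_nS(t))_n$ is increasing and converges weakly to a probability measure $\mu_t$ on $X$, and: i) $\mu_t$ is translation invariant; ii) $\int\eta(0)\,d\mu_t(\eta)\le\int\eta(0)\,d\mu(\eta)$; iii) $\mu_{t+s}=(\mu_t)_s$ for all $s,t\ge 0$ (where $(\mu_t)_s=\lim_n[\mu_t]_nS(s)$); iv) if $(\mu_n)_n$ is an increasing sequence of probability measures on $X_f$ that converges weakly to $\mu$, then $\lim_n\mu_nS(t)=\mu_t$. -/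

import Mathlib

open MeasureTheory Filter Topology
open scoped ENNReal

namespace ZeroRange

/-- The lattice `ℤ^d`. -/
abbrev Site (d : ℕ) : Type := Fin d → ℤ

/-- The configuration space `X = ℕ₀^{ℤ^d}`, with the product topology and its (product) Borel
σ-algebra, and with the coordinatewise partial order. -/
abbrev Config (d : ℕ) : Type := Site d → ℕ

/-- The set `X_f` of configurations with finitely many particles. -/
def finiteConfigs (d : ℕ) : Set (Config d) := {η | (Function.support η).Finite}

/-- Translation invariant transition probabilities on `ℤ^d`. -/
structure IsTranslationInvariantTransition {d : ℕ} (p : Site d → Site d → ℝ) : Prop where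
  nonneg : ∀ x y, 0 ≤ p x y
  sum_eq_one : ∀ x, HasSum (p x) 1
  translate : ∀ x y z, p (x + z) (y + z) = p x y

/-- The configuration `η^{x,y}`: one particle (if there is one) is moved from `x` to `y`.
It is only used for `x ≠ y`. -/
def jump {d : ℕ} (η : Config d) (x y : Site d) : Config d := fun z =>
  if η x = 0 then η z
  else if z = x then η x - 1
  else if z = y then η y + 1
  else η z

/-- The generator
`L f(η) = ∑_{x ≠ y} g(η(x)) p(x,y) (f(η^{x,y}) - f(η))`.
If `η` has finitely many particles, `g 0 = 0` and `f` is bounded on the configurations with as many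
particles as `η`, then the sum converges absolutely. -/
noncomputable def generator {d : ℕ} (g : ℕ → ℝ) (p : Site d → Site d → ℝ)
    (f : Config d → ℝ) (η : Config d) : ℝ :=
  ∑' xy : Site d × Site d,
    if xy.1 ≠ xy.2 then g (η xy.1) * p xy.1 xy.2 * (f (jump η xy.1 xy.2) - f η) else 0

/-- The semigroup `S(t) = e^{tL} = ∑_k t^k L^k / k!` of the finite-particle process, to be evaluated
at configurations `η` with finitely many particles. The dynamics conserves the number `N` of
particles, and on the configurations with `N` particles the jump rates are bounded by `N g(N)`; so
`L` is there a bounded operator for the supremum norm, the series converges absolutely for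
bounded `f`, and `S(t) f(η)` is the expectation of `f(η_t)` for the Markov chain with
generator `L` started from `η`. -/
noncomputable def semigroup {d : ℕ} (g : ℕ → ℝ) (p : Site d → Site d → ℝ) (t : ℝ)
    (f : Config d → ℝ) (η : Config d) : ℝ :=
  ∑' k : ℕ, t ^ k / (k.factorial : ℝ) * ((generator g p)^[k] f) η

/-- The probability that the finite-particle process started from `η` is at `ξ` at time `t`. -/
noncomputable def transitionProb {d : ℕ} (g : ℕ → ℝ) (p : Site d → Site d → ℝ) (t : ℝ)
    (η ξ : Config d) : ℝ :=
  semigroup g p t (Set.indicator {ξ} (fun _ => 1)) η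

/-- The law `μ S(t)`, for a measure `μ` on `X` that is concentrated on the countable set `X_f`:
it gives to `ξ ∈ X_f` the mass `∑_{η ∈ X_f} μ{η} P^η(η_t = ξ)`. -/
noncomputable def evolve {d : ℕ} (g : ℕ → ℝ) (p : Site d → Site d → ℝ) (t : ℝ)
    (μ : Measure (Config d)) : Measure (Config d) :=
  Measure.sum fun η : finiteConfigs d => Measure.sum fun ξ : finiteConfigs d =>
    (μ {(η : Config d)} * ENNReal.ofReal (transitionProb g p t η ξ)) •
      Measure.dirac (ξ : Config d)

/-- The translation `T^x`. -/
def shift {d : ℕ} (x : Site d) (η : Config d) : Config d := fun y => η (y - x)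

/-- Translation invariant measures on `X`. -/
def TranslationInvariant {d : ℕ} (μ : Measure (Config d)) : Prop :=
  ∀ x : Site d, μ.map (shift x) = μ

open Classical in
/-- The configuration that agrees with `η` on the box `[-n,n]^d` and is empty outside of it. -/
noncomputable def boxConfig {d : ℕ} (n : ℕ) (η : Config d) : Config d := fun x =>
  if ∀ i, |x i| ≤ (n : ℤ) then η x else 0

/-- The measure `[μ]_n`: the law under `μ` of the configuration restricted to `[-n,n]^d`. -/
noncomputable def boxLaw {d : ℕ} (n : ℕ) (μ : Measure (Config d)) : Measure (Config d) :=
  μ.map (boxConfig n)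

/-- A function on `X` is local if it depends on finitely many coordinates. -/
def IsLocal {d : ℕ} (f : Config d → ℝ) : Prop :=
  ∃ A : Finset (Site d), ∀ η ξ : Config d, (∀ x ∈ A, η x = ξ x) → f η = f ξ

/-- The stochastic order `μ ≤ ν`, through bounded local increasing functions. -/
def StochLE {d : ℕ} (μ ν : Measure (Config d)) : Prop :=
  ∀ f : Config d → ℝ, (∃ C : ℝ, ∀ η, |f η| ≤ C) → IsLocal f → Monotone f →
    ∫ η, f η ∂μ ≤ ∫ η, f η ∂ν

/-- Weak convergence of a sequence of probability measures on `X` to a probability measure;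
that all of them are probability measures is part of the assertion. -/
def WeaklyConverges {d : ℕ} (ν : ℕ → Measure (Config d)) (μ : Measure (Config d)) : Prop :=
  ∃ (N : ℕ → ProbabilityMeasure (Config d)) (M : ProbabilityMeasure (Config d)),
    (∀ n, (N n : Measure (Config d)) = ν n) ∧ (M : Measure (Config d)) = μ ∧
      Tendsto N atTop (𝓝 M)

open Classical in
/-- The measure `μ_t`: the weak limit of `[μ]_n S(t)` as `n → ∞`. It is a weak limit if there is one,
and then the only one, since weak limits in `X` are unique; otherwise it is the zero measure. -/
noncomputable def limitLaw {d : ℕ} (g : ℕ → ℝ) (p : Site d → Site d → ℝ)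
    (μ : Measure (Config d)) (t : ℝ) : Measure (Config d) :=
  if h : ∃ ν : Measure (Config d), WeaklyConverges (fun n => evolve g p t (boxLaw n μ)) ν
  then h.choose else 0

end ZeroRange

/-!
The number of particles is conserved, and with at most `N` particles the total jump rate is at most
`N g(N)`. There `S(t)` is the exponential of a bounded operator on bounded functions, and
`exp (t L) = exp (-t C) exp (t (L + C))` with `C = N g(N)`. For this `C` the operator `L + C`
preserves both nonnegative and increasing functions, the latter because `g` is non-decreasing
(`IsZeroRange.generator_add_mono`). Hence `S(t)` is a Markov semigroup on finite configurations, it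
maps increasing functions to increasing functions (`semigroup_monotoneOn`), and it commutes with
translations.

By attractiveness and translation invariance, a translate of `[μ]_n S(t)` lies below
`[μ]_{n+k} S(t)` if the translation is by a vector in `[-k,k]^d`
(`lintegral_shift_evolve_boxLaw_le`). So the sequence increases. Moreover, the mean occupation
number at a site under `[μ]_n S(t)` is at most the average of the mean occupation numbers over
`[-k,k]^d` under a later law, up to a fixed change of the box; by conservation of particles, this
average tends to at most the density of `μ` as `k → ∞` (`lintegral_apply_evolve_boxLaw_le`). The
laws are therefore tight, and an increasing tight sequence converges, as increasing local functions
determine weak convergence (`exists_tendsto_of_mean_le`, `tendsto_of_isTest`).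

Translation invariance and the bound on the mean pass to the limit. That any increasing
approximation of `μ` gives the same limit (`weaklyConverges_evolve`) follows by comparing `S(t) f`
with the local functions `η ↦ S(t) f([η]_m)`, and the semigroup property is this statement for the
approximation `[μ]_n S(t)` of `μ_t`.
-/

namespace ZeroRange

variable {d : ℕ} {g : ℕ → ℝ} {p : Site d → Site d → ℝ}

/-! ### Particle number and jumps -/

/-- The number of particles of a configuration, possibly infinite. -/
noncomputable def mass (η : Config d) : ℝ≥0∞ := ∑' x, (η x : ℝ≥0∞)

lemma mass_mono {η ξ : Config d} (h : η ≤ ξ) : mass η ≤ mass ξ :=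
  ENNReal.tsum_le_tsum fun x => by exact_mod_cast h x

lemma apply_le_mass (η : Config d) (x : Site d) : (η x : ℝ≥0∞) ≤ mass η :=
  ENNReal.le_tsum x

lemma mem_finiteConfigs_iff {η : Config d} : η ∈ finiteConfigs d ↔ mass η ≠ ∞ := by
  constructor
  · intro h
    have hs : ∑' x, (η x : ℝ≥0∞) = ∑ x ∈ h.toFinset, (η x : ℝ≥0∞) :=
      tsum_eq_sum fun x hx => by simpa [Function.mem_support] using (h.mem_toFinset.not.1 hx)
    rw [mass, hs]
    exact ENNReal.sum_ne_top.2 fun x _ => ENNReal.natCast_ne_top _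
  · intro h
    refine (ENNReal.finite_const_le_of_tsum_ne_top h one_ne_zero).subset fun x hx => ?_
    have : 1 ≤ η x := Nat.one_le_iff_ne_zero.2 hx
    exact_mod_cast this

lemma mem_finiteConfigs_of_mass_le {η : Config d} {N : ℕ} (h : mass η ≤ N) :
    η ∈ finiteConfigs d :=
  mem_finiteConfigs_iff.2 (ne_top_of_le_ne_top (ENNReal.natCast_ne_top N) h)

lemma exists_mass_le {η : Config d} (h : η ∈ finiteConfigs d) : ∃ N : ℕ, mass η ≤ N := by
  obtain ⟨N, hN⟩ := ENNReal.exists_nat_gt (mem_finiteConfigs_iff.1 h)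
  exact ⟨N, hN.le⟩

lemma countable_finiteConfigs : (finiteConfigs d).Countable := by
  have : finiteConfigs d ⊆ Set.range fun f : Site d →₀ ℕ => (f : Config d) := fun η hη =>
    ⟨Finsupp.ofSupportFinite η hη, rfl⟩
  exact (Set.countable_range _).mono this

instance : Countable (finiteConfigs d) := countable_finiteConfigs.to_subtype

lemma jump_of_eq_zero {η : Config d} {x : Site d} (h : η x = 0) (y : Site d) :
    jump η x y = η := by
  funext z; simp [jump, h]

lemma mass_jump (η : Config d) {x y : Site d} (hxy : x ≠ y) : mass (jump η x y) = mass η := by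
  by_cases h : η x = 0
  · rw [jump_of_eq_zero h]
  · have key : mass (jump η x y) + 1 = mass η + 1 := by
      have hx : ∑' z : Site d, (if z = x then (1 : ℝ≥0∞) else 0) = 1 := tsum_ite_eq x _
      have hy : ∑' z : Site d, (if z = y then (1 : ℝ≥0∞) else 0) = 1 := tsum_ite_eq y _
      conv_lhs => rw [← hx]
      conv_rhs => rw [← hy]
      rw [mass, mass, ← ENNReal.tsum_add, ← ENNReal.tsum_add]
      refine tsum_congr fun z => ?_
      by_cases hzx : z = x
      · subst hzx
        have : η z - 1 + 1 = η z := by omega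
        simp only [jump, h, if_true, if_false, hxy, add_zero]
        exact_mod_cast this
      · by_cases hzy : z = y
        · subst hzy; simp [jump, h, hzx]
        · simp [jump, h, hzx, hzy]
    exact (ENNReal.add_left_inj ENNReal.one_ne_top).1 key

lemma jump_le_jump {η ξ : Config d} (h : η ≤ ξ) {x y : Site d} (hx : η x ≠ 0) :
    jump η x y ≤ jump ξ x y := by
  intro z
  have h1 : η x ≤ ξ x := h x
  have h2 : η z ≤ ξ z := h z
  have h3 : η y ≤ ξ y := h y
  have hξ : ξ x ≠ 0 := by omega
  simp only [jump, hx, hξ, if_false]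
  split_ifs <;> omega

lemma le_jump {η ξ : Config d} (h : η ≤ ξ) {x y : Site d} (hx : η x < ξ x) :
    η ≤ jump ξ x y := by
  intro z
  have h2 : η z ≤ ξ z := h z
  have hξ : ξ x ≠ 0 := by omega
  simp only [jump, hξ, if_false]
  split_ifs with h1 h3
  · subst h1; omega
  · subst h3; omega
  · exact h2

lemma shift_apply (z : Site d) (η : Config d) (x : Site d) : shift z η x = η (x - z) := rfl

lemma mass_shift (z : Site d) (η : Config d) : mass (shift z η) = mass η :=
  (Equiv.subRight z).tsum_eq fun x => (η x : ℝ≥0∞)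

lemma shift_jump (z : Site d) (η : Config d) (x y : Site d) :
    shift z (jump η x y) = jump (shift z η) (x + z) (y + z) := by
  funext w
  simp only [jump, shift_apply, add_sub_cancel_right, sub_eq_iff_eq_add]

lemma shift_mem_finiteConfigs (z : Site d) {η : Config d} :
    shift z η ∈ finiteConfigs d ↔ η ∈ finiteConfigs d := by
  rw [mem_finiteConfigs_iff, mem_finiteConfigs_iff, mass_shift]

/-! ### Jump rates and the generator -/

/-- The rate of the jump from `x` to `y` in the configuration `η`. -/
noncomputable def rate (g : ℕ → ℝ) (p : Site d → Site d → ℝ) (η : Config d)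
    (xy : Site d × Site d) : ℝ :=
  if xy.1 ≠ xy.2 then g (η xy.1) * p xy.1 xy.2 else 0

lemma generator_eq (f : Config d → ℝ) (η : Config d) :
    generator g p f η =
      ∑' xy : Site d × Site d, rate g p η xy * (f (jump η xy.1 xy.2) - f η) := by
  refine tsum_congr fun xy => ?_
  unfold rate
  split_ifs <;> simp

/-- The generator at `η` only sees configurations with as many particles as `η`. -/
lemma generator_congr {f f' : Config d → ℝ} {η : Config d}
    (h : ∀ ξ, mass ξ = mass η → f ξ = f' ξ) : generator g p f η = generator g p f' η := by
  refine tsum_congr fun xy => ?_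
  split_ifs with hxy
  · rw [h _ (mass_jump η hxy), h η rfl]
  · rfl

/-- The hypotheses on the rate function and on the transition probabilities under which the
dynamics is attractive and preserves the particle number. -/
structure IsZeroRange (g : ℕ → ℝ) (p : Site d → Site d → ℝ) : Prop where
  zero : g 0 = 0
  mono : Monotone g
  trans : IsTranslationInvariantTransition p

namespace IsZeroRange

lemma nonneg (h : IsZeroRange g p) (n : ℕ) : 0 ≤ g n := h.zero ▸ h.mono n.zero_le

lemma rate_nonneg (h : IsZeroRange g p) (η : Config d) (xy) : 0 ≤ rate g p η xy := by
  unfold rate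
  split_ifs
  · exact mul_nonneg (h.nonneg _) (h.trans.nonneg _ _)
  · exact le_rfl

lemma rate_mono (h : IsZeroRange g p) {η ξ : Config d} (hηξ : η ≤ ξ) (xy) :
    rate g p η xy ≤ rate g p ξ xy := by
  unfold rate
  split_ifs
  · exact mul_le_mul_of_nonneg_right (h.mono (hηξ _)) (h.trans.nonneg _ _)
  · exact le_rfl

lemma rate_of_eq_zero (h : IsZeroRange g p) {η : Config d} {xy : Site d × Site d}
    (hη : η xy.1 = 0) : rate g p η xy = 0 := by
  simp [rate, hη, h.zero]

lemma tsum_ofReal_rate_le (h : IsZeroRange g p) {η : Config d} {N : ℕ} (hη : mass η ≤ N) :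
    ∑' xy, ENNReal.ofReal (rate g p η xy) ≤ ENNReal.ofReal (N * g N) := by
  have hp1 : ∀ x, ∑' y, ENNReal.ofReal (p x y) = 1 := fun x => by
    rw [← ENNReal.ofReal_tsum_of_nonneg (h.trans.nonneg x) (h.trans.sum_eq_one x).summable,
      (h.trans.sum_eq_one x).tsum_eq, ENNReal.ofReal_one]
  have hle : ∀ xy : Site d × Site d, ENNReal.ofReal (rate g p η xy) ≤
      (η xy.1 : ℝ≥0∞) * ENNReal.ofReal (g N) * ENNReal.ofReal (p xy.1 xy.2) := by
    rintro ⟨x, y⟩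
    rcases Nat.eq_zero_or_pos (η x) with hx | hx
    · rw [h.rate_of_eq_zero (xy := (x, y)) hx]; simp
    · have hxN : η x ≤ N := by exact_mod_cast (apply_le_mass η x).trans hη
      rw [← ENNReal.ofReal_natCast, ← ENNReal.ofReal_mul (by positivity),
        ← ENNReal.ofReal_mul (mul_nonneg (by positivity) (h.nonneg _))]
      refine ENNReal.ofReal_le_ofReal ?_
      have h1 : (1 : ℝ) ≤ η x := by exact_mod_cast hx
      have h2 : g (η x) ≤ η x * g N :=
        (h.mono hxN).trans (le_mul_of_one_le_left (h.nonneg _) h1)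
      have h3 := h.trans.nonneg x y
      unfold rate
      split_ifs
      · exact mul_le_mul_of_nonneg_right h2 h3
      · exact mul_nonneg (mul_nonneg (by positivity) (h.nonneg _)) h3
  calc ∑' xy, ENNReal.ofReal (rate g p η xy)
      ≤ ∑' xy : Site d × Site d,
          (η xy.1 : ℝ≥0∞) * ENNReal.ofReal (g N) * ENNReal.ofReal (p xy.1 xy.2) :=
        ENNReal.tsum_le_tsum hle
    _ = mass η * ENNReal.ofReal (g N) := by
        rw [ENNReal.tsum_prod']
        simp only [ENNReal.tsum_mul_left, hp1, mul_one, ENNReal.tsum_mul_right, mass]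
    _ ≤ N * ENNReal.ofReal (g N) := by gcongr
    _ = ENNReal.ofReal (N * g N) := by
        rw [ENNReal.ofReal_mul (by positivity), ENNReal.ofReal_natCast]

lemma summable_rate (h : IsZeroRange g p) {η : Config d} {N : ℕ} (hη : mass η ≤ N) :
    Summable (rate g p η) := by
  have h1 := ne_top_of_le_ne_top ENNReal.ofReal_ne_top (h.tsum_ofReal_rate_le hη)
  refine (ENNReal.summable_toReal h1).congr fun xy => ?_
  rw [ENNReal.toReal_ofReal (h.rate_nonneg _ _)]

lemma tsum_rate_le (h : IsZeroRange g p) {η : Config d} {N : ℕ} (hη : mass η ≤ N) :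
    ∑' xy, rate g p η xy ≤ N * g N := by
  have h1 := h.tsum_ofReal_rate_le hη
  rwa [← ENNReal.ofReal_tsum_of_nonneg (h.rate_nonneg η) (h.summable_rate hη),
    ENNReal.ofReal_le_ofReal_iff (mul_nonneg (by positivity) (h.nonneg _))] at h1

lemma abs_rate_mul_le (h : IsZeroRange g p) {f : Config d → ℝ} {M : ℝ}
    {N : ℕ} {η : Config d} (hη : mass η ≤ N) (hf : ∀ ξ, mass ξ ≤ N → |f ξ| ≤ M) (xy) :
    |rate g p η xy * (f (jump η xy.1 xy.2) - f η)| ≤ rate g p η xy * (2 * M) := by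
  by_cases hxy : xy.1 = xy.2
  · simp [rate, hxy]
  · rw [abs_mul, abs_of_nonneg (h.rate_nonneg _ _)]
    refine mul_le_mul_of_nonneg_left ?_ (h.rate_nonneg _ _)
    have h1 := hf _ ((mass_jump η hxy).le.trans hη)
    have h2 := hf _ hη
    have h3 := abs_sub (f (jump η xy.1 xy.2)) (f η)
    linarith

lemma summable_generator (h : IsZeroRange g p) {f : Config d → ℝ} {M : ℝ}
    {N : ℕ} {η : Config d} (hη : mass η ≤ N) (hf : ∀ ξ, mass ξ ≤ N → |f ξ| ≤ M) :
    Summable fun xy : Site d × Site d => rate g p η xy * (f (jump η xy.1 xy.2) - f η) :=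
  Summable.of_norm_bounded ((h.summable_rate hη).mul_right (2 * M)) fun xy =>
    h.abs_rate_mul_le hη hf xy

lemma abs_generator_le (h : IsZeroRange g p) {f : Config d → ℝ} {M : ℝ}
    {N : ℕ} {η : Config d} (hη : mass η ≤ N) (hf : ∀ ξ, mass ξ ≤ N → |f ξ| ≤ M) :
    |generator g p f η| ≤ 2 * (N * g N) * M := by
  have hM : 0 ≤ M := (abs_nonneg _).trans (hf η hη)
  rw [generator_eq]
  calc |∑' xy : Site d × Site d, rate g p η xy * (f (jump η xy.1 xy.2) - f η)|
      ≤ ∑' xy, rate g p η xy * (2 * M) :=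
        tsum_of_norm_bounded (f := fun xy : Site d × Site d =>
          rate g p η xy * (f (jump η xy.1 xy.2) - f η))
          ((h.summable_rate hη).mul_right (2 * M)).hasSum fun xy => h.abs_rate_mul_le hη hf xy
    _ = (∑' xy, rate g p η xy) * (2 * M) := tsum_mul_right
    _ ≤ (N * g N) * (2 * M) := by gcongr; exact h.tsum_rate_le hη
    _ = 2 * (N * g N) * M := by ring

/-- As `C = N g(N)` bounds the total jump rate, `L + C` is a positive operator. -/
lemma generator_add_nonneg (h : IsZeroRange g p) {f : Config d → ℝ} {M : ℝ}
    {N : ℕ} {η : Config d} (hη : mass η ≤ N) (hf : ∀ ξ, mass ξ ≤ N → |f ξ| ≤ M)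
    (hf0 : ∀ ξ, mass ξ ≤ N → 0 ≤ f ξ) :
    0 ≤ generator g p f η + N * g N * f η := by
  have h1 : ∑' xy, rate g p η xy * -f η ≤
      ∑' xy : Site d × Site d, rate g p η xy * (f (jump η xy.1 xy.2) - f η) := by
    refine Summable.tsum_le_tsum (fun xy => ?_) ((h.summable_rate hη).mul_right _)
      (h.summable_generator hη hf)
    by_cases hxy : xy.1 = xy.2
    · simp [rate, hxy]
    · refine mul_le_mul_of_nonneg_left ?_ (h.rate_nonneg _ _)
      linarith [hf0 _ ((mass_jump η hxy).le.trans hη)]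
  rw [tsum_mul_right, ← generator_eq] at h1
  have h2 := mul_le_mul_of_nonneg_right (h.tsum_rate_le hη) (hf0 _ hη)
  linarith

/-- As `C = N g(N)` bounds the total jump rate, `L + C` maps increasing functions to increasing
functions. Termwise, the excess of the jump rate of `ξ` over that of `η ≤ ξ` at a site is carried
by jumps of `ξ` alone, which occur only if `ξ` has more particles there, and then do not destroy
the order. -/
lemma generator_add_mono (h : IsZeroRange g p) {f : Config d → ℝ} {M : ℝ}
    {N : ℕ} {η ξ : Config d} (hηξ : η ≤ ξ) (hξ : mass ξ ≤ N)
    (hf : ∀ ξ, mass ξ ≤ N → |f ξ| ≤ M)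
    (hmono : ∀ η ξ, η ≤ ξ → mass ξ ≤ N → f η ≤ f ξ) :
    generator g p f η + N * g N * f η ≤ generator g p f ξ + N * g N * f ξ := by
  have hη : mass η ≤ N := (mass_mono hηξ).trans hξ
  have hΔ : 0 ≤ f ξ - f η := sub_nonneg.2 (hmono _ _ hηξ hξ)
  have h1 : ∑' xy, (rate g p ξ xy * -(f ξ - f η) +
        rate g p η xy * (f (jump η xy.1 xy.2) - f η)) ≤
      ∑' xy : Site d × Site d, rate g p ξ xy * (f (jump ξ xy.1 xy.2) - f ξ) := by
    refine Summable.tsum_le_tsum (fun xy => ?_)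
      (((h.summable_rate hξ).mul_right _).add (h.summable_generator hη hf))
      (h.summable_generator hξ hf)
    by_cases hxy : xy.1 = xy.2
    · simp [rate, hxy]
    have hJξ : mass (jump ξ xy.1 xy.2) ≤ N := (mass_jump ξ hxy).le.trans hξ
    -- jumps made by both configurations
    have hboth : 0 ≤ rate g p η xy * (f (jump ξ xy.1 xy.2) - f (jump η xy.1 xy.2)) := by
      by_cases h0 : η xy.1 = 0
      · rw [h.rate_of_eq_zero h0, zero_mul]
      · exact mul_nonneg (h.rate_nonneg _ _)
          (sub_nonneg.2 (hmono _ _ (jump_le_jump hηξ h0) hJξ))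
    -- jumps made by the larger configuration alone
    have halone : 0 ≤ (rate g p ξ xy - rate g p η xy) * (f (jump ξ xy.1 xy.2) - f η) := by
      rcases (hηξ xy.1).eq_or_lt with h0 | h0
      · have : rate g p ξ xy = rate g p η xy := by simp [rate, h0]
        rw [this, sub_self, zero_mul]
      · exact mul_nonneg (sub_nonneg.2 (h.rate_mono hηξ xy))
          (sub_nonneg.2 (hmono _ _ (le_jump hηξ h0) hJξ))
    nlinarith
  rw [Summable.tsum_add ((h.summable_rate hξ).mul_right _) (h.summable_generator hη hf),
    tsum_mul_right, ← generator_eq, ← generator_eq] at h1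
  have h2 := mul_le_mul_of_nonneg_right (h.tsum_rate_le hξ) hΔ
  linarith

end IsZeroRange

lemma generator_shift (hp : IsTranslationInvariantTransition p) (z : Site d) (f : Config d → ℝ)
    (η : Config d) :
    generator g p (fun ξ => f (shift z ξ)) η = generator g p f (shift z η) := by
  refine Eq.trans (tsum_congr fun xy => ?_)
    (((Equiv.addRight z).prodCongr (Equiv.addRight z)).tsum_eq _)
  simp only [Equiv.prodCongr_apply, Prod.map_fst, Prod.map_snd, Equiv.coe_addRight, shift_jump,
    hp.translate, ne_eq, add_left_inj, shift_apply, add_sub_cancel_right]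

/-! ### Exponentials of bounded operators -/

section Exponential

variable {B : Type*} [NormedAddCommGroup B] [NormedSpace ℝ B]

lemma pow_succ_apply (L : B →L[ℝ] B) (k : ℕ) (F : B) : (L ^ (k + 1)) F = L ((L ^ k) F) := by
  rw [pow_succ']; rfl

lemma norm_pow_apply_le (L : B →L[ℝ] B) (k : ℕ) {F : B} {M : ℝ} (hF : ‖F‖ ≤ M) :
    ‖(L ^ k) F‖ ≤ ‖L‖ ^ k * M := by
  induction k with
  | zero => simpa using hF
  | succ k ih =>
    rw [pow_succ_apply, pow_succ', mul_assoc]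
    exact (L.le_opNorm _).trans (by gcongr)

variable [CompleteSpace B]

lemma hasSum_exp_smul_apply (L : B →L[ℝ] B) (t : ℝ) (F : B) :
    HasSum (fun k : ℕ => (t ^ k / (k.factorial : ℝ)) • (L ^ k) F)
      (NormedSpace.exp (t • L) F) := by
  have := (ContinuousLinearMap.apply ℝ B F).hasSum
    (NormedSpace.exp_series_hasSum_exp' (𝕂 := ℝ) (t • L))
  refine this.congr_fun fun k => ?_
  simp only [smul_pow, ContinuousLinearMap.apply_apply, smul_apply, smul_smul, div_eq_inv_mul]

lemma exp_add_smul (L : B →L[ℝ] B) (t s : ℝ) :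
    NormedSpace.exp ((t + s) • L) = NormedSpace.exp (t • L) * NormedSpace.exp (s • L) := by
  let _ := NormedAlgebra.restrictScalars ℚ ℝ (B →L[ℝ] B)
  rw [add_smul, NormedSpace.exp_add_of_commute (((Commute.refl _).smul_left _).smul_right _)]

/-- If `L + C` preserves the cone on which the functionals `ψ i` are nonnegative, then so does
`exp (t L)` for `t ≥ 0`, since `exp (t L) = exp (-t C) exp (t (L + C))`. -/
lemma exp_smul_nonneg_of_forall {ι : Type*} (L : B →L[ℝ] B) (C t : ℝ) (ht : 0 ≤ t)
    (ψ : ι → B →L[ℝ] ℝ)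
    (h : ∀ F, (∀ i, 0 ≤ ψ i F) → ∀ i, 0 ≤ ψ i (L F) + C * ψ i F)
    {F : B} (hF : ∀ i, 0 ≤ ψ i F) (i : ι) : 0 ≤ ψ i (NormedSpace.exp (t • L) F) := by
  let _ := NormedAlgebra.restrictScalars ℚ ℝ (B →L[ℝ] B)
  set A : B →L[ℝ] B := L + C • 1 with hA
  have hpow : ∀ k i, 0 ≤ ψ i ((A ^ k) F) := by
    intro k
    induction k with
    | zero => simpa using hF
    | succ k ih =>
      intro i
      have := h _ ih i
      rw [pow_succ']
      simpa [hA] using this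
  have hexp : NormedSpace.exp (t • L) = Real.exp (-(t * C)) • NormedSpace.exp (t • A) := by
    have h1 : t • L = (-(t * C)) • (1 : B →L[ℝ] B) + t • A := by
      rw [hA, smul_add, smul_smul, neg_smul]; abel
    have h2 : NormedSpace.exp ((-(t * C)) • (1 : B →L[ℝ] B)) = Real.exp (-(t * C)) • 1 := by
      rw [← Algebra.algebraMap_eq_smul_one, ← NormedSpace.algebraMap_exp_comm,
        Algebra.algebraMap_eq_smul_one, Real.exp_eq_exp_ℝ]
    rw [h1, NormedSpace.exp_add_of_commute ((Commute.one_left _).smul_left _), h2,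
      smul_mul_assoc, one_mul]
  have h0 : 0 ≤ ψ i (NormedSpace.exp (t • A) F) := by
    refine ((ψ i).hasSum (hasSum_exp_smul_apply A t F)).nonneg fun k => ?_
    rw [map_smul, smul_eq_mul]
    have := hpow k i
    positivity
  rw [hexp]
  simpa using mul_nonneg (Real.exp_pos _).le h0

end Exponential

/-! ### The semigroup on configurations with a bounded number of particles -/

/-- The Banach space of bounded functions of the configuration. -/
abbrev Observable (d : ℕ) : Type := lp (fun _ : Config d => ℝ) ∞

lemma Observable.abs_apply_le (F : Observable d) (η : Config d) : |F η| ≤ ‖F‖ :=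
  lp.norm_apply_le_norm (by simp) F η

open Classical in
/-- The generator on the configurations with at most `N` particles, extended by `0` to the other
ones, as a bounded operator. -/
noncomputable def levelGenerator (h : IsZeroRange g p) (N : ℕ) :
    Observable d →L[ℝ] Observable d :=
  have hbound : ∀ (F : Observable d) (η : Config d),
      |if mass η ≤ N then generator g p F η else 0| ≤ 2 * (N * g N) * ‖F‖ := fun F η => by
    have := h.nonneg N
    split_ifs with hη
    · exact h.abs_generator_le hη fun ξ _ => F.abs_apply_le ξ
    · rw [abs_zero]; positivity
  LinearMap.mkContinuous
    { toFun := fun F => ⟨fun η => if mass η ≤ N then generator g p F η else 0,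
        memℓp_infty ⟨_, Set.forall_mem_range.2 (hbound F)⟩⟩
      map_add' := fun F G => by
        refine lp.ext (funext fun η => ?_)
        simp only [lp.coeFn_add, Pi.add_apply]
        split_ifs with hη
        · rw [generator_eq, generator_eq, generator_eq, ← Summable.tsum_add
            (h.summable_generator hη fun ξ _ => F.abs_apply_le ξ)
            (h.summable_generator hη fun ξ _ => G.abs_apply_le ξ)]
          refine tsum_congr fun xy => ?_
          simp only [Pi.add_apply]
          ring
        · simp
      map_smul' := fun c F => by
        refine lp.ext (funext fun η => ?_)
        simp only [lp.coeFn_smul, Pi.smul_apply, RingHom.id_apply, smul_eq_mul]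
        split_ifs with hη
        · rw [generator_eq, generator_eq, ← tsum_mul_left]
          refine tsum_congr fun xy => ?_
          simp only [Pi.smul_apply, smul_eq_mul]
          ring
        · simp }
    (2 * (N * g N)) fun F => lp.norm_le_of_forall_le
      (by have := h.nonneg N; positivity) (hbound F)

lemma levelGenerator_apply (h : IsZeroRange g p) {N : ℕ} (F : Observable d) {η : Config d}
    (hη : mass η ≤ N) : levelGenerator h N F η = generator g p F η :=
  if_pos hη

lemma levelGenerator_apply_of_not (h : IsZeroRange g p) {N : ℕ} (F : Observable d) {η : Config d}
    (hη : ¬ mass η ≤ N) : levelGenerator h N F η = 0 :=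
  if_neg hη

lemma levelGenerator_pow_apply (h : IsZeroRange g p) {N : ℕ} {F : Observable d}
    {f : Config d → ℝ} (hF : ∀ ξ, mass ξ ≤ N → F ξ = f ξ) (k : ℕ) {η : Config d}
    (hη : mass η ≤ N) : (levelGenerator h N ^ k) F η = (generator g p)^[k] f η := by
  induction k generalizing η with
  | zero => simpa using hF η hη
  | succ k ih =>
    rw [pow_succ_apply, Function.iterate_succ_apply', levelGenerator_apply h _ hη]
    exact generator_congr fun ξ hξ => ih (hξ.le.trans hη)

/-- The semigroup of the bounded operator `levelGenerator h N`. -/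
noncomputable def levelSemigroup (h : IsZeroRange g p) (N : ℕ) (t : ℝ) :
    Observable d →L[ℝ] Observable d :=
  NormedSpace.exp (t • levelGenerator h N)

lemma hasSum_levelSemigroup (h : IsZeroRange g p) (N : ℕ) (t : ℝ) (F : Observable d)
    (η : Config d) :
    HasSum (fun k : ℕ => t ^ k / (k.factorial : ℝ) * (levelGenerator h N ^ k) F η)
      (levelSemigroup h N t F η) := by
  exact (lp.evalCLM ℝ (fun _ : Config d => ℝ) ∞ η).hasSum
    (hasSum_exp_smul_apply (levelGenerator h N) t F)

/-- On the configurations with at most `N` particles the semigroup is the exponential of a bounded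
operator. -/
lemma semigroup_eq (h : IsZeroRange g p) {N : ℕ} {F : Observable d}
    {f : Config d → ℝ} (hF : ∀ ξ, mass ξ ≤ N → F ξ = f ξ) (t : ℝ) {η : Config d}
    (hη : mass η ≤ N) : semigroup g p t f η = levelSemigroup h N t F η := by
  rw [← (hasSum_levelSemigroup h N t F η).tsum_eq]
  refine tsum_congr fun k => ?_
  rw [levelGenerator_pow_apply h hF k hη]

lemma levelSemigroup_add (h : IsZeroRange g p) (N : ℕ) (t s : ℝ) :
    levelSemigroup h N (t + s) = levelSemigroup h N t * levelSemigroup h N s :=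
  exp_add_smul _ t s

lemma levelSemigroup_nonneg (h : IsZeroRange g p) {N : ℕ} {t : ℝ} (ht : 0 ≤ t) {F : Observable d}
    (hF : ∀ η, mass η ≤ N → 0 ≤ F η) {η : Config d} (hη : mass η ≤ N) :
    0 ≤ levelSemigroup h N t F η := by
  refine exp_smul_nonneg_of_forall (levelGenerator h N) (N * g N) t ht
    (fun η : {η : Config d // mass η ≤ N} => lp.evalCLM ℝ (fun _ : Config d => ℝ) ∞ η.1)
    (fun G hG i => ?_) (fun i => hF _ i.2) ⟨η, hη⟩
  have := h.generator_add_nonneg i.2 (fun ξ _ => G.abs_apply_le ξ) fun ξ hξ => hG ⟨ξ, hξ⟩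
  rw [← levelGenerator_apply h G i.2] at this
  exact this

lemma levelSemigroup_mono (h : IsZeroRange g p) {N : ℕ} {t : ℝ} (ht : 0 ≤ t) {F : Observable d}
    (hF : ∀ η ξ, η ≤ ξ → mass ξ ≤ N → F η ≤ F ξ) {η ξ : Config d} (hηξ : η ≤ ξ)
    (hξ : mass ξ ≤ N) : levelSemigroup h N t F η ≤ levelSemigroup h N t F ξ := by
  refine sub_nonneg.1 (exp_smul_nonneg_of_forall (levelGenerator h N) (N * g N) t ht
    (fun q : {q : Config d × Config d // q.1 ≤ q.2 ∧ mass q.2 ≤ N} =>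
      lp.evalCLM ℝ (fun _ : Config d => ℝ) ∞ q.1.2 - lp.evalCLM ℝ (fun _ : Config d => ℝ) ∞ q.1.1)
    (fun G hG i => ?_) (fun i => sub_nonneg.2 (hF _ _ i.2.1 i.2.2)) ⟨(η, ξ), hηξ, hξ⟩)
  have := h.generator_add_mono i.2.1 i.2.2 (fun ξ _ => G.abs_apply_le ξ)
    fun η ξ hle hξ => sub_nonneg.1 (hG ⟨(η, ξ), hle, hξ⟩)
  rw [← levelGenerator_apply h G i.2.2,
    ← levelGenerator_apply h G ((mass_mono i.2.1).trans i.2.2)] at this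
  have h2 : 0 ≤ (levelGenerator h N G i.1.2 - levelGenerator h N G i.1.1) +
      N * g N * (G i.1.2 - G i.1.1) := by linarith
  exact h2

/-- The level semigroups are continuous for bounded pointwise convergence. -/
lemma tendsto_levelSemigroup (h : IsZeroRange g p) {N : ℕ} (t : ℝ) {ι : Type*} {l : Filter ι}
    {F : ι → Observable d} {G : Observable d} {M : ℝ} (hM : ∀ i, ‖F i‖ ≤ M)
    (hlim : ∀ η, Tendsto (fun i => F i η) l (𝓝 (G η))) (η : Config d) :
    Tendsto (fun i => levelSemigroup h N t (F i) η) l (𝓝 (levelSemigroup h N t G η)) := by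
  set A := levelGenerator h N with hA
  have hpowbd : ∀ k i, ‖(A ^ k) (F i)‖ ≤ ‖A‖ ^ k * M := fun k i => norm_pow_apply_le A k (hM i)
  have hpow : ∀ k η, Tendsto (fun i => (A ^ k) (F i) η) l (𝓝 ((A ^ k) G η)) := by
    intro k
    induction k with
    | zero => simpa using hlim
    | succ k ih =>
      intro η
      simp only [pow_succ_apply]
      by_cases hη : mass η ≤ N
      · simp only [hA, levelGenerator_apply h _ hη, generator_eq]
        refine tendsto_tsum_of_dominated_convergence
          (bound := fun xy => rate g p η xy * (2 * (‖A‖ ^ k * M)))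
          ((h.summable_rate hη).mul_right _) (fun xy => ?_) (.of_forall fun i xy => ?_)
        · exact Tendsto.const_mul (M := ℝ) _ (Tendsto.sub (G := ℝ) (ih _) (ih _))
        · exact h.abs_rate_mul_le hη
            (fun ξ _ => (Observable.abs_apply_le _ ξ).trans (hpowbd k i)) xy
      · simp only [hA, levelGenerator_apply_of_not h _ hη]
        exact tendsto_const_nhds
  simp only [← (hasSum_levelSemigroup h N t _ η).tsum_eq]
  refine tendsto_tsum_of_dominated_convergence
    (bound := fun k : ℕ => (|t| * ‖A‖) ^ k / (k.factorial : ℝ) * M)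
    ((Real.summable_pow_div_factorial _).mul_right _) (fun k => (hpow k η).const_mul _)
    (.of_forall fun i k => ?_)
  rw [Real.norm_eq_abs, abs_mul, abs_div, abs_pow, Nat.abs_cast, mul_pow]
  calc |t| ^ k / (k.factorial : ℝ) * |(A ^ k) (F i) η|
      ≤ |t| ^ k / (k.factorial : ℝ) * (‖A‖ ^ k * M) := by
        gcongr
        exact (Observable.abs_apply_le _ η).trans (hpowbd k i)
    _ = |t| ^ k * ‖A‖ ^ k / (k.factorial : ℝ) * M := by ring

/-! ### The Markov semigroup on finite configurations -/

/-- Boundedness on the configurations with finitely many particles. -/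
def FiniteBounded (f : Config d → ℝ) : Prop := ∃ M : ℝ, ∀ η ∈ finiteConfigs d, |f η| ≤ M

lemma exists_observable {f : Config d → ℝ} {M : ℝ} {N : ℕ} (hf : ∀ ξ ∈ finiteConfigs d, |f ξ| ≤ M)
    (hM : 0 ≤ M) : ∃ F : Observable d, ‖F‖ ≤ M ∧ (∀ ξ, mass ξ ≤ N → F ξ = f ξ) ∧
      ∀ ξ, ¬ mass ξ ≤ N → F ξ = 0 := by
  classical
  have hb : ∀ ξ, ‖if mass ξ ≤ N then f ξ else 0‖ ≤ M := fun ξ => by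
    split_ifs with h
    · exact hf ξ (mem_finiteConfigs_of_mass_le h)
    · simpa using hM
  exact ⟨⟨fun ξ => if mass ξ ≤ N then f ξ else 0, memℓp_infty ⟨M, Set.forall_mem_range.2 hb⟩⟩,
    lp.norm_le_of_forall_le hM hb, fun ξ h => if_pos h, fun ξ h => if_neg h⟩

lemma FiniteBounded.exists_observable {f : Config d → ℝ} (hf : FiniteBounded f) (N : ℕ) :
    ∃ F : Observable d, ∀ ξ, mass ξ ≤ N → F ξ = f ξ := by
  obtain ⟨M, hM⟩ := hf
  obtain ⟨F, -, hF, -⟩ := ZeroRange.exists_observable (N := N)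
    (fun ξ hξ => (hM ξ hξ).trans (le_abs_self M)) (abs_nonneg M)
  exact ⟨F, hF⟩

lemma finiteBounded_indicator (s : Set (Config d)) :
    FiniteBounded (s.indicator fun _ => (1 : ℝ)) := by
  refine ⟨1, fun η _ => ?_⟩
  by_cases h : η ∈ s <;> simp [h]

lemma finiteBounded_const (c : ℝ) : FiniteBounded fun _ : Config d => c := ⟨|c|, fun _ _ => le_rfl⟩

lemma iterate_generator_congr {f f' : Config d → ℝ} {η : Config d}
    (h : ∀ ξ, mass ξ = mass η → f ξ = f' ξ) (k : ℕ) :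
    (generator g p)^[k] f η = (generator g p)^[k] f' η := by
  induction k generalizing η with
  | zero => exact h η rfl
  | succ k ih =>
    rw [Function.iterate_succ_apply', Function.iterate_succ_apply']
    exact generator_congr fun ξ hξ => ih fun ζ hζ => h ζ (hζ.trans hξ)

lemma semigroup_congr {f f' : Config d → ℝ} {η : Config d}
    (h : ∀ ξ, mass ξ = mass η → f ξ = f' ξ) (t : ℝ) :
    semigroup g p t f η = semigroup g p t f' η :=
  tsum_congr fun k => by rw [iterate_generator_congr h k]

lemma semigroup_const (t c : ℝ) (η : Config d) : semigroup g p t (fun _ => c) η = c := by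
  have h0 : ∀ c : ℝ, generator g p (fun _ => c) = fun _ => 0 := fun c =>
    funext fun η => by simp [generator_eq]
  have hk : ∀ k : ℕ, (generator g p)^[k + 1] (fun _ => c) = fun _ => 0 := fun k => by
    induction k with
    | zero => simpa using h0 c
    | succ k ih => rw [Function.iterate_succ_apply', ih, h0]
  rw [semigroup, tsum_eq_single 0]
  · simp
  · rintro (_ | k) hk0
    · exact absurd rfl hk0
    · rw [hk, mul_zero]

lemma semigroup_shift (hp : IsTranslationInvariantTransition p) (t : ℝ) (z : Site d)
    (f : Config d → ℝ) (η : Config d) :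
    semigroup g p t (fun ξ => f (shift z ξ)) η = semigroup g p t f (shift z η) := by
  have hk : ∀ k : ℕ, (generator g p)^[k] (fun ξ => f (shift z ξ)) =
      fun ξ => (generator g p)^[k] f (shift z ξ) := fun k => by
    induction k with
    | zero => rfl
    | succ k ih =>
      rw [Function.iterate_succ_apply', Function.iterate_succ_apply', ih]
      exact funext fun ξ => generator_shift hp z _ ξ
  exact tsum_congr fun k => by rw [hk]

lemma transitionProb_of_mass_ne {t : ℝ} {η ξ : Config d} (h : mass ξ ≠ mass η) :
    transitionProb g p t η ξ = 0 := by
  rw [transitionProb, semigroup_congr (f' := fun _ => 0), semigroup_const]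
  rintro ζ hζ
  exact Set.indicator_of_notMem (fun hmem => h (by rwa [← Set.mem_singleton_iff.1 hmem])) _

variable {t s : ℝ} {f f' : Config d → ℝ}

lemma semigroup_le (h : IsZeroRange g p) (ht : 0 ≤ t) (hf : FiniteBounded f)
    (hf' : FiniteBounded f') (hle : ∀ η ∈ finiteConfigs d, f η ≤ f' η) {η : Config d}
    (hη : η ∈ finiteConfigs d) : semigroup g p t f η ≤ semigroup g p t f' η := by
  obtain ⟨N, hN⟩ := exists_mass_le hη
  obtain ⟨F, hF⟩ := hf.exists_observable N
  obtain ⟨F', hF'⟩ := hf'.exists_observable N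
  rw [semigroup_eq h hF t hN, semigroup_eq h hF' t hN]
  have := levelSemigroup_nonneg h (F := F' - F) ht (fun ξ hξ => by
    simpa [hF ξ hξ, hF' ξ hξ] using hle ξ (mem_finiteConfigs_of_mass_le hξ)) hN
  rw [map_sub] at this
  exact sub_nonneg.1 this

lemma semigroup_nonneg (h : IsZeroRange g p) (ht : 0 ≤ t) (hf : FiniteBounded f)
    (hf0 : ∀ η ∈ finiteConfigs d, 0 ≤ f η) {η : Config d}
    (hη : η ∈ finiteConfigs d) : 0 ≤ semigroup g p t f η := by
  simpa [semigroup_const] using semigroup_le h ht (finiteBounded_const 0) hf hf0 hη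

lemma semigroup_finiteBounded (h : IsZeroRange g p) (ht : 0 ≤ t) (hf : FiniteBounded f) :
    FiniteBounded (semigroup g p t f) := by
  have hf' := hf
  obtain ⟨M, hM⟩ := hf'
  refine ⟨M, fun η hη => abs_le.2 ⟨?_, ?_⟩⟩
  · simpa [semigroup_const] using semigroup_le h ht (finiteBounded_const (-M)) hf
      (fun ξ hξ => (abs_le.1 (hM ξ hξ)).1) hη
  · simpa [semigroup_const] using semigroup_le h ht hf (finiteBounded_const M)
      (fun ξ hξ => (abs_le.1 (hM ξ hξ)).2) hη

/-- Attractiveness: the semigroup maps increasing functions to increasing functions. -/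
lemma semigroup_monotoneOn (h : IsZeroRange g p) (ht : 0 ≤ t) (hf : FiniteBounded f)
    (hmono : MonotoneOn f (finiteConfigs d)) :
    MonotoneOn (semigroup g p t f) (finiteConfigs d) := by
  intro η _ ξ hξ hηξ
  obtain ⟨N, hN⟩ := exists_mass_le hξ
  obtain ⟨F, hF⟩ := hf.exists_observable N
  rw [semigroup_eq h hF t hN, semigroup_eq h hF t ((mass_mono hηξ).trans hN)]
  refine levelSemigroup_mono h ht (fun η ξ hle hξ => ?_) hηξ hN
  have hη := (mass_mono hle).trans hξ
  rw [hF _ hξ, hF _ hη]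
  exact hmono (mem_finiteConfigs_of_mass_le hη) (mem_finiteConfigs_of_mass_le hξ) hle

lemma semigroup_semigroup (h : IsZeroRange g p) (hf : FiniteBounded f)
    {η : Config d} (hη : η ∈ finiteConfigs d) :
    semigroup g p t (semigroup g p s f) η = semigroup g p (t + s) f η := by
  obtain ⟨N, hN⟩ := exists_mass_le hη
  obtain ⟨F, hF⟩ := hf.exists_observable N
  rw [semigroup_eq h hF (t + s) hN, levelSemigroup_add,
    semigroup_eq h (F := levelSemigroup h N s F) (fun ξ hξ => (semigroup_eq h hF s hξ).symm) t hN]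
  rfl

lemma transitionProb_nonneg (h : IsZeroRange g p) (ht : 0 ≤ t) {η : Config d}
    (hη : η ∈ finiteConfigs d) (ξ : Config d) : 0 ≤ transitionProb g p t η ξ :=
  semigroup_nonneg h ht (finiteBounded_indicator _)
    (fun ζ _ => Set.indicator_nonneg (fun _ _ => zero_le_one) ζ) hη

/-- The semigroup is given by the transition probabilities. -/
lemma hasSum_transitionProb (h : IsZeroRange g p) (t : ℝ) (hf : FiniteBounded f)
    {η : Config d} (hη : η ∈ finiteConfigs d) :
    HasSum (fun ξ : finiteConfigs d => transitionProb g p t η ξ * f ξ)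
      (semigroup g p t f η) := by
  classical
  obtain ⟨N, hN⟩ := exists_mass_le hη
  obtain ⟨M, hM⟩ := hf
  have hM0 : 0 ≤ |M| := abs_nonneg M
  replace hM : ∀ ξ ∈ finiteConfigs d, |f ξ| ≤ |M| := fun ξ hξ => (hM ξ hξ).trans (le_abs_self M)
  -- the partial sums are the semigroup applied to the restrictions of `f` to finite sets
  let fA : Finset (finiteConfigs d) → Config d → ℝ := fun A ξ =>
    ∑ ζ ∈ A, f ζ * Set.indicator {(ζ : Config d)} (fun _ => (1 : ℝ)) ξ
  have hfA : ∀ A (ξ : finiteConfigs d), fA A ξ = if ξ ∈ A then f ξ else 0 := fun A ξ => by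
    simp only [fA, Set.indicator_apply, Set.mem_singleton_iff, mul_ite, mul_one, mul_zero,
      ← Subtype.ext_iff, Finset.sum_ite_eq]
  have hbd : ∀ A, ∀ ξ ∈ finiteConfigs d, |fA A ξ| ≤ |M| := fun A ξ hξ => by
    rw [hfA A ⟨ξ, hξ⟩]
    split_ifs
    · exact hM ξ hξ
    · rwa [abs_zero]
  choose F hFM hF hF0 using fun A => exists_observable (N := N) (hbd A) hM0
  obtain ⟨G, -, hG, hG0⟩ := exists_observable (N := N) hM hM0
  choose E hE using fun ξ : finiteConfigs d =>
    (finiteBounded_indicator {(ξ : Config d)}).exists_observable N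
  have hpartial : ∀ A : Finset (finiteConfigs d),
      ∑ ξ ∈ A, transitionProb g p t η ξ * f ξ = levelSemigroup h N t (F A) η := fun A => by
    have hsum : ∀ ξ, mass ξ ≤ N → (∑ ζ ∈ A, f ζ • E ζ : Observable d) ξ = fA A ξ := fun ξ hξ => by
      rw [lp.coeFn_sum, Finset.sum_apply]
      exact Finset.sum_congr rfl fun ζ _ => by
        rw [lp.coeFn_smul, Pi.smul_apply, smul_eq_mul, hE ζ ξ hξ]
    rw [← semigroup_eq h (hF A) t hN, semigroup_eq h hsum t hN, map_sum, lp.coeFn_sum,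
      Finset.sum_apply]
    refine Finset.sum_congr rfl fun ζ _ => ?_
    rw [map_smul, lp.coeFn_smul, Pi.smul_apply, smul_eq_mul, mul_comm, transitionProb,
      semigroup_eq h (hE ζ) t hN]
  have hlim : ∀ ξ, Tendsto (fun A => F A ξ) atTop (𝓝 (G ξ)) := fun ξ => by
    by_cases hξ : mass ξ ≤ N
    · have hξf := mem_finiteConfigs_of_mass_le hξ
      refine tendsto_const_nhds.congr' ?_
      filter_upwards [eventually_ge_atTop {(⟨ξ, hξf⟩ : finiteConfigs d)}] with A hA
      rw [hF A ξ hξ, hG ξ hξ, hfA A ⟨ξ, hξf⟩, if_pos (hA (Finset.mem_singleton_self _))]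
    · simp only [hF0 _ ξ hξ, hG0 ξ hξ]
      exact tendsto_const_nhds
  have := tendsto_levelSemigroup h (N := N) t hFM hlim η
  rw [← semigroup_eq h hG t hN] at this
  simpa only [HasSum, SummationFilter.unconditional_filter, hpartial] using this

lemma tsum_ofReal_transitionProb (h : IsZeroRange g p) (ht : 0 ≤ t) (hf : FiniteBounded f)
    (hf0 : ∀ η ∈ finiteConfigs d, 0 ≤ f η) {η : Config d} (hη : η ∈ finiteConfigs d) :
    ∑' ξ : finiteConfigs d, ENNReal.ofReal (transitionProb g p t η ξ) * ENNReal.ofReal (f ξ) =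
      ENNReal.ofReal (semigroup g p t f η) := by
  have hs := hasSum_transitionProb h t hf hη
  rw [← hs.tsum_eq, ENNReal.ofReal_tsum_of_nonneg _ hs.summable]
  · exact tsum_congr fun ξ => (ENNReal.ofReal_mul (transitionProb_nonneg h ht hη _)).symm
  · exact fun ξ => mul_nonneg (transitionProb_nonneg h ht hη _) (hf0 _ ξ.2)

/-! ### The evolution of laws on finite configurations -/

lemma measurableSet_finiteConfigs : MeasurableSet (finiteConfigs d) :=
  countable_finiteConfigs.measurableSet

/-- No measurability of `F` is needed, as `ν` sits on a countable set. -/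
lemma lintegral_of_finiteConfigs {ν : Measure (Config d)} (hν : ν (finiteConfigs d)ᶜ = 0)
    (F : Config d → ℝ≥0∞) : ∫⁻ η, F η ∂ν = ∑' η : finiteConfigs d, ν {(η : Config d)} * F η := by
  have : ν.restrict (finiteConfigs d) = ν := Measure.restrict_eq_self_of_ae_mem hν
  conv_lhs => rw [← this]
  rw [lintegral_countable _ countable_finiteConfigs]
  exact tsum_congr fun η => mul_comm _ _

lemma lintegral_evolve (t : ℝ) (ν : Measure (Config d)) (F : Config d → ℝ≥0∞) :
    ∫⁻ ξ, F ξ ∂evolve g p t ν = ∑' η : finiteConfigs d, ν {(η : Config d)} *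
      ∑' ξ : finiteConfigs d, ENNReal.ofReal (transitionProb g p t η ξ) * F ξ := by
  rw [evolve, lintegral_sum_measure]
  refine tsum_congr fun η => ?_
  rw [lintegral_sum_measure, ← ENNReal.tsum_mul_left]
  refine tsum_congr fun ξ => ?_
  rw [lintegral_smul_measure, lintegral_dirac, smul_eq_mul, mul_assoc]

variable {ν : Measure (Config d)}

lemma lintegral_ofReal_evolve (h : IsZeroRange g p) (ht : 0 ≤ t)
    (hν : ν (finiteConfigs d)ᶜ = 0) (hf : FiniteBounded f)
    (hf0 : ∀ η ∈ finiteConfigs d, 0 ≤ f η) :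
    ∫⁻ ξ, ENNReal.ofReal (f ξ) ∂evolve g p t ν =
      ∫⁻ η, ENNReal.ofReal (semigroup g p t f η) ∂ν := by
  rw [lintegral_evolve, lintegral_of_finiteConfigs hν]
  exact tsum_congr fun η => by rw [tsum_ofReal_transitionProb h ht hf hf0 η.2]

lemma evolve_compl_finiteConfigs (t : ℝ) (ν : Measure (Config d)) :
    evolve g p t ν (finiteConfigs d)ᶜ = 0 := by
  rw [← lintegral_indicator_one measurableSet_finiteConfigs.compl, lintegral_evolve]
  simp

lemma isProbabilityMeasure_evolve (h : IsZeroRange g p) (ht : 0 ≤ t) [IsProbabilityMeasure ν]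
    (hν : ν (finiteConfigs d)ᶜ = 0) : IsProbabilityMeasure (evolve g p t ν) := by
  have := lintegral_ofReal_evolve h ht hν (finiteBounded_const 1) fun _ _ => zero_le_one
  simp only [semigroup_const, ENNReal.ofReal_one, lintegral_const, measure_univ, one_mul] at this
  exact ⟨this⟩

lemma evolve_evolve (h : IsZeroRange g p) (ht : 0 ≤ t) (hs : 0 ≤ s)
    (hν : ν (finiteConfigs d)ᶜ = 0) :
    evolve g p s (evolve g p t ν) = evolve g p (t + s) ν := by
  refine Measure.ext fun B hB => ?_
  have hf := finiteBounded_indicator B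
  have hf0 : ∀ η ∈ finiteConfigs d, 0 ≤ B.indicator (fun _ => (1 : ℝ)) η := fun η _ =>
    Set.indicator_nonneg (fun _ _ => zero_le_one) η
  have hB1 : B.indicator (1 : Config d → ℝ≥0∞) =
      fun η => ENNReal.ofReal (B.indicator (fun _ => (1 : ℝ)) η) := by
    funext η
    by_cases hη : η ∈ B <;> simp [hη]
  rw [← lintegral_indicator_one hB, ← lintegral_indicator_one hB, hB1,
    lintegral_ofReal_evolve h hs (evolve_compl_finiteConfigs _ _) hf hf0,
    lintegral_ofReal_evolve h ht hν (semigroup_finiteBounded h hs hf)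
      (fun η hη => semigroup_nonneg h hs hf hf0 hη),
    lintegral_ofReal_evolve h (add_nonneg ht hs) hν hf hf0,
    lintegral_of_finiteConfigs hν, lintegral_of_finiteConfigs hν]
  exact tsum_congr fun η => by rw [semigroup_semigroup h hf η.2]

/-- The dynamics preserves the mean number of particles. -/
lemma lintegral_mass_evolve (h : IsZeroRange g p) (ht : 0 ≤ t)
    (hν : ν (finiteConfigs d)ᶜ = 0) :
    ∫⁻ ξ, mass ξ ∂evolve g p t ν = ∫⁻ η, mass η ∂ν := by
  rw [lintegral_evolve, lintegral_of_finiteConfigs hν]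
  refine tsum_congr fun η => ?_
  congr 1
  have h1 := tsum_ofReal_transitionProb h ht (finiteBounded_const 1) (fun _ _ => zero_le_one) η.2
  simp only [semigroup_const, ENNReal.ofReal_one, mul_one] at h1
  calc ∑' ξ : finiteConfigs d, ENNReal.ofReal (transitionProb g p t η ξ) * mass (ξ : Config d)
      = ∑' ξ : finiteConfigs d,
          ENNReal.ofReal (transitionProb g p t η ξ) * mass (η : Config d) :=
        tsum_congr fun ξ => by
          by_cases hm : mass (ξ : Config d) = mass (η : Config d)
          · rw [hm]
          · rw [transitionProb_of_mass_ne hm]; simp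
    _ = mass (η : Config d) := by rw [ENNReal.tsum_mul_right, h1, one_mul]

/-! ### Restriction to boxes -/

lemma boxConfig_le (n : ℕ) (η : Config d) : boxConfig n η ≤ η := fun x => by
  unfold boxConfig
  split_ifs
  exacts [le_rfl, Nat.zero_le _]

lemma boxConfig_mono (n : ℕ) {η ξ : Config d} (h : η ≤ ξ) : boxConfig n η ≤ boxConfig n ξ :=
  fun x => by
    unfold boxConfig
    split_ifs
    exacts [h x, le_rfl]

/-- The box `[-n,n]^d`. -/
noncomputable def box (d n : ℕ) : Finset (Site d) := Finset.Icc (fun _ => -(n : ℤ)) fun _ => (n : ℤ)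

lemma mem_box {n : ℕ} {x : Site d} : x ∈ box d n ↔ ∀ i, |x i| ≤ (n : ℤ) := by
  simp [box, Pi.le_def, abs_le, forall_and]

lemma card_box (d n : ℕ) : (box d n).card = (2 * n + 1) ^ d := by
  rw [box, Pi.card_Icc]
  simp only [Int.card_Icc, Finset.prod_const, Finset.card_univ, Fintype.card_fin]
  congr 1
  omega

lemma exists_mem_box (x : Site d) : ∃ n, x ∈ box d n :=
  ⟨∑ i, (x i).natAbs, mem_box.2 fun i => by
    rw [Int.abs_eq_natAbs]
    exact_mod_cast Finset.single_le_sum (f := fun i => (x i).natAbs) (fun _ _ => Nat.zero_le _)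
      (Finset.mem_univ i)⟩

lemma boxConfig_apply (n : ℕ) (η : Config d) (x : Site d) :
    boxConfig n η x = if x ∈ box d n then η x else 0 := by
  simp only [mem_box]
  unfold boxConfig
  congr

lemma boxConfig_mem (n : ℕ) (η : Config d) : boxConfig n η ∈ finiteConfigs d :=
  (box d n).finite_toSet.subset fun x hx => by
    by_contra hx'
    exact hx (by rw [boxConfig_apply, if_neg (by simpa using hx')])

lemma mass_boxConfig (n : ℕ) (η : Config d) :
    mass (boxConfig n η) = ∑ x ∈ box d n, (η x : ℝ≥0∞) := by
  rw [mass, tsum_eq_sum (s := box d n) fun x hx => by simp [boxConfig_apply, hx]]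
  exact Finset.sum_congr rfl fun x hx => by rw [boxConfig_apply, if_pos hx]

/-- A finite configuration lies in all large boxes. -/
lemma eventually_boxConfig_eq {η : Config d} (hη : η ∈ finiteConfigs d) :
    ∀ᶠ n in atTop, boxConfig n η = η := by
  have : ∀ x ∈ hη.toFinset, ∀ᶠ n in atTop, x ∈ box d n := fun x _ => by
    obtain ⟨n, hn⟩ := exists_mem_box x
    filter_upwards [eventually_ge_atTop n] with m hm
    exact mem_box.2 fun i => (mem_box.1 hn i).trans (by exact_mod_cast hm)
  filter_upwards [(Filter.eventually_all_finset _).2 this] with n hn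
  funext x
  rw [boxConfig_apply]
  split_ifs with hx
  · rfl
  · by_contra h0
    exact hx (hn x (hη.mem_toFinset.2 (Ne.symm h0)))

/-- Shifting a box by a vector of length at most `k` keeps it in the box that is larger by `k`. -/
lemma shift_boxConfig_le {n k : ℕ} {z : Site d} (hz : z ∈ box d k) (η : Config d) :
    shift z (boxConfig n η) ≤ boxConfig (n + k) (shift z η) := fun x => by
  rw [shift_apply, boxConfig_apply, boxConfig_apply]
  split_ifs with h1 h2
  · exact le_rfl
  · refine absurd (mem_box.2 fun i => ?_) h2
    have h3 := mem_box.1 h1 i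
    have h4 := mem_box.1 hz i
    rw [Pi.sub_apply, abs_le] at h3
    rw [abs_le] at h4 ⊢
    push_cast
    constructor <;> linarith [h3.1, h3.2, h4.1, h4.2]
  · exact Nat.zero_le _
  · exact le_rfl

lemma measurable_shift (z : Site d) : Measurable (shift (d := d) z) :=
  measurable_pi_lambda _ fun x => measurable_pi_apply (x - z)

lemma measurable_boxConfig (n : ℕ) : Measurable (boxConfig (d := d) n) :=
  measurable_pi_lambda _ fun x => by
    simp only [boxConfig_apply]
    split_ifs
    exacts [measurable_pi_apply x, measurable_const]

lemma isProbabilityMeasure_boxLaw (n : ℕ) (μ : Measure (Config d)) [IsProbabilityMeasure μ] :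
    IsProbabilityMeasure (boxLaw n μ) :=
  Measure.isProbabilityMeasure_map (measurable_boxConfig n).aemeasurable

lemma boxLaw_compl_finiteConfigs (n : ℕ) (μ : Measure (Config d)) :
    boxLaw n μ (finiteConfigs d)ᶜ = 0 := by
  rw [boxLaw, Measure.map_apply (measurable_boxConfig n) measurableSet_finiteConfigs.compl]
  convert measure_empty (μ := μ)
  ext η
  simp [boxConfig_mem]

lemma measurable_comp_boxConfig {β : Type*} [MeasurableSpace β] (n : ℕ) (F : Config d → β) :
    Measurable fun η => F (boxConfig n η) := by
  have h1 : Measurable fun η : finiteConfigs d => F η := measurable_of_countable _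
  have h2 : Measurable fun η => (⟨boxConfig n η, boxConfig_mem n η⟩ : finiteConfigs d) :=
    (measurable_boxConfig n).subtype_mk
  exact h1.comp h2

lemma lintegral_boxLaw (n : ℕ) (μ : Measure (Config d)) (F : Config d → ℝ≥0∞) :
    ∫⁻ η, F η ∂boxLaw n μ = ∫⁻ η, F (boxConfig n η) ∂μ := by
  have h0 : ∀ᵐ η ∂boxLaw n μ, η ∈ finiteConfigs d := boxLaw_compl_finiteConfigs n μ
  have h1 : Measurable ((finiteConfigs d).indicator F) :=
    measurable_of_restrict_of_restrict_compl measurableSet_finiteConfigs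
      (measurable_of_countable _) (by
        convert measurable_const (a := (0 : ℝ≥0∞)) using 1
        exact funext fun η => Set.indicator_of_notMem η.2 F)
  calc ∫⁻ η, F η ∂boxLaw n μ = ∫⁻ η, (finiteConfigs d).indicator F η ∂boxLaw n μ :=
        lintegral_congr_ae (h0.mono fun η hη => (Set.indicator_of_mem hη F).symm)
    _ = ∫⁻ η, (finiteConfigs d).indicator F (boxConfig n η) ∂μ :=
        lintegral_map h1 (measurable_boxConfig n)
    _ = ∫⁻ η, F (boxConfig n η) ∂μ :=
        lintegral_congr fun η => Set.indicator_of_mem (boxConfig_mem n η) F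

/-! ### Increasing local functions and weak convergence -/

lemma IsLocal.continuous {f : Config d → ℝ} (hf : IsLocal f) : Continuous f := by
  classical
  obtain ⟨A, hA⟩ := hf
  have h1 : Continuous fun u : A → ℕ => f fun x => if h : x ∈ A then u ⟨x, h⟩ else 0 :=
    continuous_of_discreteTopology
  have h2 : Continuous fun (η : Config d) (x : A) => η x :=
    continuous_pi fun x => continuous_apply (x : Site d)
  convert h1.comp h2 using 1
  funext η
  exact hA _ _ fun x hx => by simp [hx]

lemma isLocal_comp_boxConfig (n : ℕ) (f : Config d → ℝ) :
    IsLocal fun η => f (boxConfig n η) :=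
  ⟨box d n, fun η ξ h => congrArg f (funext fun x => by
    rw [boxConfig_apply, boxConfig_apply]
    split_ifs with hx
    exacts [h x hx, rfl])⟩

lemma IsLocal.comp_shift {f : Config d → ℝ} (hf : IsLocal f) (z : Site d) :
    IsLocal fun η => f (shift z η) := by
  classical
  obtain ⟨A, hA⟩ := hf
  exact ⟨A.image fun x => x - z, fun η ξ h => hA _ _ fun x hx =>
    h _ (Finset.mem_image_of_mem _ hx)⟩

lemma shift_mono (z : Site d) {η ξ : Config d} (h : η ≤ ξ) : shift z η ≤ shift z ξ :=
  fun x => h (x - z)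

/-- The bounded, nonnegative, increasing local functions, which determine the stochastic order and
the weak topology. -/
structure IsTest (f : Config d → ℝ) : Prop where
  nonneg : ∀ η, 0 ≤ f η
  bdd : ∃ C, ∀ η, f η ≤ C
  isLocal : IsLocal f
  mono : Monotone f

namespace IsTest

lemma finiteBounded (hf : IsTest f) : FiniteBounded f := by
  obtain ⟨C, hC⟩ := hf.bdd
  exact ⟨C, fun η _ => by rw [abs_of_nonneg (hf.nonneg η)]; exact hC η⟩

lemma measurable (hf : IsTest f) : Measurable f := hf.isLocal.continuous.measurable

lemma integrable (hf : IsTest f) (μ : Measure (Config d)) [IsFiniteMeasure μ] :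
    Integrable f μ := by
  obtain ⟨C, hC⟩ := hf.bdd
  exact Integrable.of_bound hf.measurable.aestronglyMeasurable C
    (.of_forall fun η => by rw [Real.norm_of_nonneg (hf.nonneg η)]; exact hC η)

lemma ofReal_integral (hf : IsTest f) (μ : Measure (Config d)) [IsFiniteMeasure μ] :
    ENNReal.ofReal (∫ η, f η ∂μ) = ∫⁻ η, ENNReal.ofReal (f η) ∂μ :=
  ofReal_integral_eq_lintegral_ofReal (hf.integrable μ) (.of_forall hf.nonneg)

lemma integral_nonneg (hf : IsTest f) (μ : Measure (Config d)) : 0 ≤ ∫ η, f η ∂μ :=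
  MeasureTheory.integral_nonneg hf.nonneg

lemma comp_shift (hf : IsTest f) (z : Site d) : IsTest fun η => f (shift z η) where
  nonneg _ := hf.nonneg _
  bdd := hf.bdd.imp fun _ hC _ => hC _
  isLocal := hf.isLocal.comp_shift z
  mono _ _ h := hf.mono (shift_mono z h)

lemma tendsto_integral (hf : IsTest f) {ι : Type*} {l : Filter ι}
    {N : ι → ProbabilityMeasure (Config d)} {M : ProbabilityMeasure (Config d)}
    (h : Tendsto N l (𝓝 M)) :
    Tendsto (fun i => ∫ η, f η ∂(N i : Measure (Config d))) l
      (𝓝 (∫ η, f η ∂(M : Measure (Config d)))) := by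
  obtain ⟨C, hC⟩ := hf.bdd
  exact ProbabilityMeasure.tendsto_iff_forall_integral_tendsto.1 h
    (BoundedContinuousFunction.ofNormedAddCommGroup f hf.isLocal.continuous C fun η => by
      rw [Real.norm_of_nonneg (hf.nonneg η)]; exact hC η)

open Classical in
/-- Multiplication by the indicator of `{η x ≥ m}`. -/
lemma threshold (hf : IsTest f) (x : Site d) (m : ℕ) :
    IsTest fun η => if m ≤ η x then f η else 0 where
  nonneg η := by split_ifs; exacts [hf.nonneg η, le_rfl]
  bdd := by
    obtain ⟨C, hC⟩ := hf.bdd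
    refine ⟨C, fun η => ?_⟩
    split_ifs
    exacts [hC η, (hf.nonneg η).trans (hC η)]
  isLocal := by
    obtain ⟨A, hA⟩ := hf.isLocal
    refine ⟨insert x A, fun η ξ h => ?_⟩
    dsimp only
    rw [h x (Finset.mem_insert_self _ _), hA η ξ fun y hy => h y (Finset.mem_insert_of_mem hy)]
  mono η ξ h := by
    have hx : η x ≤ ξ x := h x
    dsimp only
    split_ifs with h1 h2
    exacts [hf.mono h, absurd (h1.trans hx) h2, hf.nonneg ξ, le_rfl]

end IsTest

lemma isTest_const {c : ℝ} (hc : 0 ≤ c) : IsTest fun _ : Config d => c :=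
  ⟨fun _ => hc, ⟨c, fun _ => le_rfl⟩, ⟨∅, fun _ _ _ => rfl⟩, fun _ _ _ => le_rfl⟩

lemma isTest_min (x : Site d) (K : ℕ) : IsTest fun η : Config d => ((min (η x) K : ℕ) : ℝ) where
  nonneg _ := Nat.cast_nonneg _
  bdd := ⟨K, fun η => by exact_mod_cast min_le_right _ _⟩
  isLocal := ⟨{x}, fun η ξ h => by
    dsimp only; rw [h x (Finset.mem_singleton_self x)]⟩
  mono η ξ h := by
    have hx : η x ≤ ξ x := h x
    exact Nat.cast_le.2 (min_le_min_right K hx)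

lemma stochLE_of_isTest {μ ν : Measure (Config d)} [IsProbabilityMeasure μ]
    [IsProbabilityMeasure ν]
    (h : ∀ f : Config d → ℝ, IsTest f → ∫ η, f η ∂μ ≤ ∫ η, f η ∂ν) : StochLE μ ν := by
  rintro f ⟨C, hC⟩ hloc hmono
  have hf : IsTest fun η => f η + C :=
    ⟨fun η => by linarith [(abs_le.1 (hC η)).1],
      ⟨C + C, fun η => by linarith [(abs_le.1 (hC η)).2]⟩,
      hloc.imp fun A hA η ξ hηξ => congrArg (· + C) (hA η ξ hηξ),
      fun η ξ hηξ => add_le_add_left (hmono hηξ) C⟩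
  have hi : ∀ (ρ : Measure (Config d)) [IsProbabilityMeasure ρ],
      ∫ η, f η + C ∂ρ = ∫ η, f η ∂ρ + C := fun ρ _ => by
    rw [integral_add (Integrable.of_bound hloc.continuous.measurable.aestronglyMeasurable C
      (.of_forall hC)) (integrable_const C)]
    simp
  have := h _ hf
  rw [hi, hi] at this
  linarith

lemma StochLE.integral_le {μ ν : Measure (Config d)} (h : StochLE μ ν) {f : Config d → ℝ}
    (hf : IsTest f) : ∫ η, f η ∂μ ≤ ∫ η, f η ∂ν := by
  obtain ⟨C, hC⟩ := hf.bdd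
  exact h f ⟨C, fun η => by rw [abs_of_nonneg (hf.nonneg η)]; exact hC η⟩ hf.isLocal hf.mono

/-- The configurations that agree with `a` on `A`. -/
def cylinder (A : Finset (Site d)) (a : Config d) : Set (Config d) := {η | ∀ x ∈ A, η x = a x}

lemma isOpen_cylinder (A : Finset (Site d)) (a : Config d) : IsOpen (cylinder A a) := by
  have : cylinder A a = ⋂ x ∈ A, (fun η : Config d => η x) ⁻¹' {a x} := by
    ext η; simp [cylinder]
  rw [this]
  exact isOpen_biInter_finset fun x _ => (isOpen_discrete _).preimage (continuous_apply x)

lemma isPiSystem_cylinder : IsPiSystem {C | ∃ A, ∃ a : Config d, C = cylinder A a} := by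
  classical
  rintro _ ⟨A, a, rfl⟩ _ ⟨B, b, rfl⟩ ⟨c, hcA, hcB⟩
  refine ⟨A ∪ B, c, ?_⟩
  ext η
  constructor
  · rintro ⟨h1, h2⟩ x hx
    rcases Finset.mem_union.1 hx with hx | hx
    · rw [h1 x hx, hcA x hx]
    · rw [h2 x hx, hcB x hx]
  · intro h
    exact ⟨fun x hx => by rw [h x (Finset.mem_union_left _ hx), hcA x hx],
      fun x hx => by rw [h x (Finset.mem_union_right _ hx), hcB x hx]⟩

lemma exists_cylinder_subset {u : Set (Config d)} (hu : IsOpen u) {η : Config d} (hη : η ∈ u) :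
    ∃ A, cylinder A η ⊆ u := by
  obtain ⟨A, v, hv, hsub⟩ := isOpen_pi_iff.1 hu η hη
  exact ⟨A, fun ξ hξ => hsub fun x hx => by rw [hξ x hx]; exact (hv x hx).2⟩

/-- Convergence of the integrals of increasing functions extends to products with indicators of
cylinders, since `1{η x = m} = 1{η x ≥ m} - 1{η x ≥ m + 1}`. -/
lemma tendsto_integral_cylinder {ι : Type*} {l : Filter ι}
    {N : ι → ProbabilityMeasure (Config d)} {M : ProbabilityMeasure (Config d)}
    (h : ∀ f : Config d → ℝ, IsTest f → Tendsto (fun i => ∫ η, f η ∂(N i : Measure (Config d))) l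
      (𝓝 (∫ η, f η ∂(M : Measure (Config d)))))
    (A : Finset (Site d)) (a : Config d) {f : Config d → ℝ} (hf : IsTest f) :
    Tendsto (fun i => ∫ η in cylinder A a, f η ∂(N i : Measure (Config d))) l
      (𝓝 (∫ η in cylinder A a, f η ∂(M : Measure (Config d)))) := by
  classical
  induction A using Finset.induction_on generalizing f with
  | empty => simpa [cylinder] using h f hf
  | insert x A hx ih =>
    have key : ∀ ρ : Measure (Config d), IsProbabilityMeasure ρ →
        ∫ η in cylinder (insert x A) a, f η ∂ρ =
          (∫ η in cylinder A a, (if a x ≤ η x then f η else 0) ∂ρ) -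
            ∫ η in cylinder A a, (if a x + 1 ≤ η x then f η else 0) ∂ρ := fun ρ _ => by
      rw [← integral_sub ((hf.threshold x _).integrable _) ((hf.threshold x _).integrable _),
        ← integral_indicator (isOpen_cylinder _ _).measurableSet,
        ← integral_indicator (isOpen_cylinder _ _).measurableSet]
      congr 1
      funext η
      have hmem : η ∈ cylinder (insert x A) a ↔ η x = a x ∧ η ∈ cylinder A a := by
        simp [cylinder]
      simp only [Set.indicator_apply, hmem]
      rcases lt_trichotomy (η x) (a x) with hlt | heq | hgt
      · simp [hlt.ne, hlt.not_ge, show ¬ a x + 1 ≤ η x by omega]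
      · simp [heq]
      · simp [hgt.ne', hgt.le, show a x + 1 ≤ η x by omega]
    rw [key _ inferInstance]
    simp only [fun i => key (N i : Measure (Config d)) inferInstance]
    exact (ih (hf.threshold x _)).sub (ih (hf.threshold x _))

/-- Increasing functions determine weak convergence. -/
lemma tendsto_of_isTest {ι : Type*} {l : Filter ι} [l.IsCountablyGenerated]
    {N : ι → ProbabilityMeasure (Config d)} {M : ProbabilityMeasure (Config d)}
    (h : ∀ f : Config d → ℝ, IsTest f → Tendsto (fun i => ∫ η, f η ∂(N i : Measure (Config d))) l
      (𝓝 (∫ η, f η ∂(M : Measure (Config d))))) : Tendsto N l (𝓝 M) := by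
  refine isPiSystem_cylinder.tendsto_probabilityMeasure_of_tendsto_of_mem ?_ ?_ ?_
  · rintro _ ⟨A, a, rfl⟩
    exact (isOpen_cylinder A a).measurableSet
  · intro u hu η hη
    obtain ⟨A, hA⟩ := exists_cylinder_subset hu hη
    exact ⟨_, ⟨A, η, rfl⟩, (isOpen_cylinder A η).mem_nhds fun _ _ => rfl, hA⟩
  · rintro _ ⟨A, a, rfl⟩
    have := tendsto_integral_cylinder h A a (isTest_const zero_le_one)
    simpa using this

/-- Increasing functions determine a law. -/
lemma eq_of_isTest {M M' : ProbabilityMeasure (Config d)}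
    (h : ∀ f : Config d → ℝ, IsTest f → ∫ η, f η ∂(M : Measure (Config d)) =
      ∫ η, f η ∂(M' : Measure (Config d))) : M = M' :=
  tendsto_nhds_unique (tendsto_const_nhds (f := (atTop : Filter ℕ)))
    (tendsto_of_isTest fun f hf => by rw [h f hf]; exact tendsto_const_nhds)

/-- Laws with uniformly bounded mean occupation numbers are tight: products of finite sets are
compact, and by Markov's inequality the side at the site `x` can be chosen so large that the
probabilities of leaving it have a small sum over `x`. -/
lemma isTightMeasureSet_of_mean_le {S : Set (Measure (Config d))} {ρ : ℝ≥0∞} (hρ : ρ ≠ ∞)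
    (hS : ∀ μ ∈ S, ∀ x, ∫⁻ η, (η x : ℝ≥0∞) ∂μ ≤ ρ) : IsTightMeasureSet S := by
  rw [isTightMeasureSet_iff_exists_isCompact_measure_compl_le]
  intro ε hε
  obtain ⟨δ, hδ, hsum⟩ := ENNReal.exists_pos_sum_of_countable hε.ne' (Site d)
  have hK : ∀ x, ∃ K : ℕ, ρ / ((K + 1 : ℕ) : ℝ≥0∞) ≤ δ x := fun x => by
    have hlim : Tendsto (fun K : ℕ => ρ / ((K + 1 : ℕ) : ℝ≥0∞)) atTop (𝓝 0) :=
      by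
      simpa using (ENNReal.Tendsto.const_div
        (ENNReal.tendsto_nat_nhds_top.comp (tendsto_add_atTop_nat 1)) (Or.inr hρ))
    exact ((tendsto_order.1 hlim).2 _ (by exact_mod_cast hδ x)).exists.imp fun K hK => hK.le
  choose K hK using hK
  refine ⟨Set.univ.pi fun x => Set.Iic (K x),
    isCompact_univ_pi fun x => (Set.finite_Iic _).isCompact, fun μ hμ => ?_⟩
  have hsub : (Set.univ.pi fun x => Set.Iic (K x))ᶜ ⊆
      ⋃ x, {η : Config d | ((K x + 1 : ℕ) : ℝ≥0∞) ≤ η x} := fun η hη => by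
    simp only [Set.mem_compl_iff, Set.mem_univ_pi, Set.mem_Iic, not_forall, not_le] at hη
    obtain ⟨x, hx⟩ := hη
    exact Set.mem_iUnion.2 ⟨x, by exact_mod_cast hx⟩
  calc μ (Set.univ.pi fun x => Set.Iic (K x))ᶜ
      ≤ ∑' x, μ {η : Config d | ((K x + 1 : ℕ) : ℝ≥0∞) ≤ η x} :=
        (measure_mono hsub).trans (measure_iUnion_le _)
    _ ≤ ∑' x, (δ x : ℝ≥0∞) := ENNReal.tsum_le_tsum fun x => by
        refine (meas_ge_le_lintegral_div ?_ (by simp) (by simp)).trans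
          ((ENNReal.div_le_div_right (hS μ hμ x) _).trans (hK x))
        exact ((measurable_from_top (f := fun n : ℕ => (n : ℝ≥0∞))).comp
          (measurable_pi_apply x)).aemeasurable
    _ ≤ ε := hsum.le

/-- A stochastically increasing sequence with uniformly bounded mean occupation numbers converges:
it is tight, and by monotonicity all its limit points integrate increasing functions alike. -/
lemma exists_tendsto_of_mean_le {N : ℕ → ProbabilityMeasure (Config d)} {ρ : ℝ≥0∞} (hρ : ρ ≠ ∞)
    (hmean : ∀ n x, ∫⁻ η, (η x : ℝ≥0∞) ∂(N n : Measure (Config d)) ≤ ρ)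
    (hmono : ∀ n, StochLE (N n : Measure (Config d)) (N (n + 1) : Measure (Config d))) :
    ∃ M, Tendsto N atTop (𝓝 M) := by
  have htight : IsTightMeasureSet
      {((μ : ProbabilityMeasure (Config d)) : Measure (Config d)) | μ ∈ Set.range N} := by
    refine isTightMeasureSet_of_mean_le hρ ?_
    rintro _ ⟨_, ⟨n, rfl⟩, rfl⟩
    exact hmean n
  obtain ⟨M, -, hM⟩ := (isCompact_closure_of_isTightMeasureSet htight).exists_mapClusterPt
    (f := atTop) (u := N) (by
      rw [le_principal_iff, mem_map]
      exact univ_mem' fun n => subset_closure ⟨n, rfl⟩)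
  obtain ⟨U, hU, hUM⟩ := mapClusterPt_iff_ultrafilter.1 hM
  refine ⟨M, tendsto_of_isTest fun f hf => ?_⟩
  obtain ⟨C, hC⟩ := hf.bdd
  have hmonof : Monotone fun n => ∫ η, f η ∂(N n : Measure (Config d)) :=
    monotone_nat_of_le_succ fun n => (hmono n).integral_le hf
  have hbdd : BddAbove (Set.range fun n => ∫ η, f η ∂(N n : Measure (Config d))) := by
    refine ⟨C, Set.forall_mem_range.2 fun n => ?_⟩
    calc ∫ η, f η ∂(N n : Measure (Config d)) ≤ ∫ _, C ∂(N n : Measure (Config d)) :=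
          integral_mono (hf.integrable _) (integrable_const C) hC
      _ = C := by simp
  have hlim := tendsto_atTop_ciSup hmonof hbdd
  rwa [tendsto_nhds_unique (hlim.mono_left hU) (hf.tendsto_integral hUM)] at hlim

variable {μ : Measure (Config d)}

/-! ### Evolved laws and increasing functions -/

lemma semigroup_nonneg_of_isTest (h : IsZeroRange g p) (ht : 0 ≤ t) (hf : IsTest f) {η : Config d}
    (hη : η ∈ finiteConfigs d) : 0 ≤ semigroup g p t f η :=
  semigroup_nonneg h ht hf.finiteBounded (fun η _ => hf.nonneg η) hη

/-- By attractiveness, `η ↦ S(t) f([η]_n)` is an increasing local function if `f` is. -/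
lemma IsTest.semigroup_boxConfig (h : IsZeroRange g p) (ht : 0 ≤ t) (hf : IsTest f) (n : ℕ) :
    IsTest fun η => semigroup g p t f (boxConfig n η) where
  nonneg η := semigroup_nonneg_of_isTest h ht hf (boxConfig_mem n η)
  bdd := by
    obtain ⟨M, hM⟩ := semigroup_finiteBounded h ht hf.finiteBounded
    exact ⟨M, fun η => (le_abs_self _).trans (hM _ (boxConfig_mem n η))⟩
  isLocal := isLocal_comp_boxConfig n _
  mono η ξ hle := semigroup_monotoneOn h ht hf.finiteBounded (hf.mono.monotoneOn _)
    (boxConfig_mem n η) (boxConfig_mem n ξ) (boxConfig_mono n hle)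

lemma lintegral_evolve_boxLaw (h : IsZeroRange g p) (ht : 0 ≤ t) (hf : IsTest f) (n : ℕ) :
    ∫⁻ ξ, ENNReal.ofReal (f ξ) ∂evolve g p t (boxLaw n μ) =
      ∫⁻ η, ENNReal.ofReal (semigroup g p t f (boxConfig n η)) ∂μ := by
  rw [lintegral_ofReal_evolve h ht (boxLaw_compl_finiteConfigs n μ) hf.finiteBounded
    fun η _ => hf.nonneg η, lintegral_boxLaw]

lemma isProbabilityMeasure_evolve_boxLaw (h : IsZeroRange g p) (ht : 0 ≤ t)
    [IsProbabilityMeasure μ] (n : ℕ) : IsProbabilityMeasure (evolve g p t (boxLaw n μ)) :=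
  have := isProbabilityMeasure_boxLaw n μ
  isProbabilityMeasure_evolve h ht (boxLaw_compl_finiteConfigs n μ)

lemma integral_evolve_boxLaw (h : IsZeroRange g p) (ht : 0 ≤ t) (hf : IsTest f)
    [IsProbabilityMeasure μ] (n : ℕ) :
    ∫ ξ, f ξ ∂evolve g p t (boxLaw n μ) = ∫ η, semigroup g p t f (boxConfig n η) ∂μ := by
  have := isProbabilityMeasure_evolve_boxLaw h ht (μ := μ) n
  have hF := hf.semigroup_boxConfig h ht n
  rw [← ENNReal.toReal_ofReal (hf.integral_nonneg _), hf.ofReal_integral,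
    lintegral_evolve_boxLaw h ht hf, ← hF.ofReal_integral, ENNReal.toReal_ofReal
    (hF.integral_nonneg _)]

/-- Translating the evolved law of the process in a box gives a law below the evolved law of the
process in a larger box that contains the translated one. -/
lemma lintegral_shift_evolve_boxLaw_le (h : IsZeroRange g p) (ht : 0 ≤ t)
    (hμ : TranslationInvariant μ) (hf : IsTest f) {k : ℕ} {z : Site d} (hz : z ∈ box d k) (n : ℕ) :
    ∫⁻ ξ, ENNReal.ofReal (f (shift z ξ)) ∂evolve g p t (boxLaw n μ) ≤
      ∫⁻ ξ, ENNReal.ofReal (f ξ) ∂evolve g p t (boxLaw (n + k) μ) := by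
  rw [lintegral_evolve_boxLaw h ht (hf.comp_shift z), lintegral_evolve_boxLaw h ht hf]
  conv_rhs => rw [← hμ z]
  rw [lintegral_map (measurable_comp_boxConfig _ fun η => ENNReal.ofReal (semigroup g p t f η))
    (measurable_shift z)]
  refine lintegral_mono fun η => ENNReal.ofReal_le_ofReal ?_
  rw [semigroup_shift h.trans]
  exact semigroup_monotoneOn h ht hf.finiteBounded (hf.mono.monotoneOn _)
    ((shift_mem_finiteConfigs z).2 (boxConfig_mem n η)) (boxConfig_mem _ _)
    (shift_boxConfig_le hz η)

lemma integral_shift_evolve_boxLaw_le (h : IsZeroRange g p) (ht : 0 ≤ t) [IsProbabilityMeasure μ]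
    (hμ : TranslationInvariant μ) (hf : IsTest f) {k : ℕ} {z : Site d} (hz : z ∈ box d k) (n : ℕ) :
    ∫ ξ, f (shift z ξ) ∂evolve g p t (boxLaw n μ) ≤
      ∫ ξ, f ξ ∂evolve g p t (boxLaw (n + k) μ) := by
  have := isProbabilityMeasure_evolve_boxLaw h ht (μ := μ)
  rw [← ENNReal.ofReal_le_ofReal_iff (hf.integral_nonneg _), (hf.comp_shift z).ofReal_integral,
    hf.ofReal_integral]
  exact lintegral_shift_evolve_boxLaw_le h ht hμ hf hz n

lemma stochLE_evolve_boxLaw (h : IsZeroRange g p) (ht : 0 ≤ t) [IsProbabilityMeasure μ]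
    (hμ : TranslationInvariant μ) (n : ℕ) :
    StochLE (evolve g p t (boxLaw n μ)) (evolve g p t (boxLaw (n + 1) μ)) := by
  have := isProbabilityMeasure_evolve_boxLaw h ht (μ := μ)
  refine stochLE_of_isTest fun f hf => ?_
  have h0 : (0 : Site d) ∈ box d 1 := mem_box.2 fun i => by simp
  have hs : ∀ η : Config d, shift 0 η = η := fun η => funext fun x => by simp [shift_apply]
  simpa only [hs] using integral_shift_evolve_boxLaw_le h ht hμ hf h0 n

/-! ### The mean occupation numbers -/

lemma measurable_coe_apply (x : Site d) : Measurable fun η : Config d => (η x : ℝ≥0∞) :=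
  (measurable_from_top (f := fun n : ℕ => (n : ℝ≥0∞))).comp (measurable_pi_apply x)

lemma lintegral_apply_le_of_min {x : Site d} {ρ : ℝ≥0∞}
    (hK : ∀ K : ℕ, ∫⁻ η, ENNReal.ofReal ((min (η x) K : ℕ) : ℝ) ∂ν ≤ ρ) :
    ∫⁻ η, (η x : ℝ≥0∞) ∂ν ≤ ρ := by
  have hsup : ∀ η : Config d, (η x : ℝ≥0∞) = ⨆ K : ℕ, ENNReal.ofReal ((min (η x) K : ℕ) : ℝ) :=
    fun η => by
      simp only [ENNReal.ofReal_natCast]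
      refine le_antisymm (le_iSup_of_le (η x) (by simp)) (iSup_le fun K => ?_)
      exact_mod_cast min_le_left _ _
  simp only [hsup]
  rw [lintegral_iSup (fun K => (isTest_min x K).measurable.ennreal_ofReal)]
  · exact iSup_le hK
  · intro K K' hKK η
    exact ENNReal.ofReal_le_ofReal (Nat.cast_le.2 (min_le_min_left _ hKK))

lemma lintegral_apply_eq (hμ : TranslationInvariant μ) (x : Site d) :
    ∫⁻ η, (η x : ℝ≥0∞) ∂μ = ∫⁻ η, (η 0 : ℝ≥0∞) ∂μ := by
  conv_lhs => rw [← hμ x]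
  rw [lintegral_map (measurable_coe_apply x) (measurable_shift x)]
  simp [shift_apply]

lemma lintegral_mass_evolve_boxLaw (h : IsZeroRange g p) (ht : 0 ≤ t)
    (hμ : TranslationInvariant μ) (n : ℕ) :
    ∫⁻ ξ, mass ξ ∂evolve g p t (boxLaw n μ) =
      (box d n).card * ∫⁻ η, (η 0 : ℝ≥0∞) ∂μ := by
  rw [lintegral_mass_evolve h ht (boxLaw_compl_finiteConfigs n μ), lintegral_boxLaw]
  simp only [mass_boxConfig]
  rw [lintegral_finsetSum _ fun x _ => measurable_coe_apply x]
  simp only [lintegral_apply_eq hμ, Finset.sum_const, nsmul_eq_mul]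

lemma tendsto_card_box_div (d n : ℕ) :
    Tendsto (fun k => ((box d (n + k)).card / (box d k).card : ℝ)) atTop (𝓝 1) := by
  have h1 : Tendsto (fun k : ℕ => (1 : ℝ) + 2 * n / ((2 * k + 1 : ℕ) : ℝ)) atTop (𝓝 (1 + 0)) := by
    refine tendsto_const_nhds.add (Tendsto.const_div_atTop ?_ _)
    refine tendsto_natCast_atTop_atTop.comp (tendsto_atTop_mono (fun k => ?_) tendsto_id)
    simp only [id]
    omega
  have h2 := h1.pow d
  rw [add_zero, one_pow] at h2
  refine h2.congr fun k => ?_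
  rw [card_box, card_box, Nat.cast_pow, Nat.cast_pow, ← div_pow]
  congr 1
  have : ((2 * k + 1 : ℕ) : ℝ) ≠ 0 := by positivity
  field_simp
  push_cast
  ring

/-- The mean occupation numbers of the process in a box are at most the density of `μ`. By
monotonicity, the mean at the origin is at most the mean at each site of `[-k,k]^d` for the process
in the box that is larger by `k`. The latter add up to at most the mean number of particles, which
the dynamics preserves, and the boundary effect vanishes as `k → ∞`. -/
lemma lintegral_apply_evolve_boxLaw_le (h : IsZeroRange g p) (ht : 0 ≤ t)
    (hμ : TranslationInvariant μ) (hmean : ∫⁻ η, (η 0 : ℝ≥0∞) ∂μ < ∞) (n : ℕ) (x : Site d) :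
    ∫⁻ ξ, (ξ x : ℝ≥0∞) ∂evolve g p t (boxLaw n μ) ≤ ∫⁻ η, (η 0 : ℝ≥0∞) ∂μ := by
  set ρ := ∫⁻ η, (η 0 : ℝ≥0∞) ∂μ with hρ
  refine lintegral_apply_le_of_min fun K => ?_
  set m := ∫⁻ ξ, ENNReal.ofReal ((min (ξ x) K : ℕ) : ℝ) ∂evolve g p t (boxLaw n μ) with hm
  obtain ⟨j, hj⟩ := exists_mem_box (-x)
  have hsum : ∀ k, (box d k).card * m ≤ (box d (n + j + k)).card * ρ := fun k => by
    rw [← lintegral_mass_evolve_boxLaw h ht hμ, ← nsmul_eq_mul]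
    calc (box d k).card • m
        ≤ ∑ y ∈ box d k, ∫⁻ ξ, (ξ y : ℝ≥0∞) ∂evolve g p t (boxLaw (n + j + k) μ) := by
          refine Finset.card_nsmul_le_sum _ _ _ fun y hy => ?_
          have h1 := lintegral_shift_evolve_boxLaw_le h ht hμ (isTest_min 0 K) hj n
          have h2 := lintegral_shift_evolve_boxLaw_le h ht hμ (isTest_min y K) hy (n + j)
          simp only [shift_apply, sub_neg_eq_add, zero_add, sub_self] at h1 h2
          refine (h1.trans h2).trans (lintegral_mono fun ξ => ?_)
          rw [ENNReal.ofReal_natCast]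
          exact Nat.cast_le.2 (min_le_left _ _)
      _ = ∫⁻ ξ, ∑ y ∈ box d k, (ξ y : ℝ≥0∞) ∂evolve g p t (boxLaw (n + j + k) μ) :=
          (lintegral_finsetSum _ fun y _ => measurable_coe_apply y).symm
      _ ≤ ∫⁻ ξ, mass ξ ∂evolve g p t (boxLaw (n + j + k) μ) :=
          lintegral_mono fun ξ => ENNReal.sum_le_tsum _
  have hlim : Tendsto (fun k => ENNReal.ofReal
      ((box d (n + j + k)).card / (box d k).card : ℝ) * ρ) atTop (𝓝 (1 * ρ)) := by
    have := ENNReal.tendsto_ofReal (tendsto_card_box_div d (n + j))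
    rw [ENNReal.ofReal_one] at this
    exact ENNReal.Tendsto.mul_const this (Or.inr hmean.ne)
  rw [one_mul] at hlim
  refine ge_of_tendsto' hlim fun k => ?_
  have hpos : 0 < (box d k).card := by rw [card_box]; positivity
  rw [ENNReal.ofReal_div_of_pos (by exact_mod_cast hpos), ENNReal.ofReal_natCast,
    ENNReal.ofReal_natCast, ← ENNReal.mul_div_right_comm]
  rw [ENNReal.le_div_iff_mul_le (Or.inl (by exact_mod_cast hpos.ne'))
    (Or.inl (ENNReal.natCast_ne_top _)), mul_comm]
  exact hsum k

/-! ### The limit law -/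

lemma WeaklyConverges.unique {ν : ℕ → Measure (Config d)} {μ μ' : Measure (Config d)}
    (h : WeaklyConverges ν μ) (h' : WeaklyConverges ν μ') : μ = μ' := by
  obtain ⟨N, M, hN, rfl, hlim⟩ := h
  obtain ⟨N', M', hN', rfl, hlim'⟩ := h'
  obtain rfl : N = N' := funext fun n => Subtype.ext ((hN n).trans (hN' n).symm)
  rw [tendsto_nhds_unique hlim hlim']

lemma WeaklyConverges.isProbabilityMeasure {ν : ℕ → Measure (Config d)} {μ : Measure (Config d)}
    (h : WeaklyConverges ν μ) : IsProbabilityMeasure μ := by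
  obtain ⟨_, M, _, rfl, _⟩ := h
  infer_instance

lemma WeaklyConverges.tendsto_integral {ν : ℕ → Measure (Config d)} {μ : Measure (Config d)}
    (h : WeaklyConverges ν μ) (hf : IsTest f) :
    Tendsto (fun n => ∫ η, f η ∂ν n) atTop (𝓝 (∫ η, f η ∂μ)) := by
  obtain ⟨N, M, hN, rfl, hlim⟩ := h
  simpa only [hN] using hf.tendsto_integral hlim

lemma weaklyConverges_of_isTest {ν : ℕ → Measure (Config d)} {μ : Measure (Config d)}
    (hν : ∀ n, IsProbabilityMeasure (ν n)) [hμ : IsProbabilityMeasure μ]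
    (h : ∀ f : Config d → ℝ, IsTest f →
      Tendsto (fun n => ∫ η, f η ∂ν n) atTop (𝓝 (∫ η, f η ∂μ))) : WeaklyConverges ν μ :=
  ⟨fun n => ⟨ν n, hν n⟩, ⟨μ, hμ⟩, fun _ => rfl, rfl, tendsto_of_isTest h⟩

lemma weaklyConverges_limitLaw (h : IsZeroRange g p) (ht : 0 ≤ t) [IsProbabilityMeasure μ]
    (hμ : TranslationInvariant μ) (hmean : ∫⁻ η, (η 0 : ℝ≥0∞) ∂μ < ∞) :
    WeaklyConverges (fun n => evolve g p t (boxLaw n μ)) (limitLaw g p μ t) := by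
  have hex : ∃ ν, WeaklyConverges (fun n => evolve g p t (boxLaw n μ)) ν := by
    obtain ⟨M, hM⟩ := exists_tendsto_of_mean_le
      (N := fun n => ⟨_, isProbabilityMeasure_evolve_boxLaw h ht (μ := μ) n⟩) hmean.ne
      (fun n x => lintegral_apply_evolve_boxLaw_le h ht hμ hmean n x)
      (fun n => stochLE_evolve_boxLaw h ht hμ n)
    exact ⟨M, _, M, fun _ => rfl, rfl, hM⟩
  rw [limitLaw, dif_pos hex]
  exact hex.choose_spec

lemma translationInvariant_limitLaw (h : IsZeroRange g p) (ht : 0 ≤ t) [IsProbabilityMeasure μ]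
    (hμ : TranslationInvariant μ) (hmean : ∫⁻ η, (η 0 : ℝ≥0∞) ∂μ < ∞) :
    TranslationInvariant (limitLaw g p μ t) := by
  have hconv := weaklyConverges_limitLaw h ht hμ hmean
  have := hconv.isProbabilityMeasure
  have hle : ∀ (f : Config d → ℝ) (z : Site d), IsTest f →
      ∫ η, f (shift z η) ∂limitLaw g p μ t ≤ ∫ η, f η ∂limitLaw g p μ t := fun f z hf => by
    obtain ⟨k, hk⟩ := exists_mem_box z
    exact le_of_tendsto_of_tendsto' (hconv.tendsto_integral (hf.comp_shift z))
      ((hconv.tendsto_integral hf).comp (tendsto_add_atTop_nat k))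
      fun n => integral_shift_evolve_boxLaw_le h ht hμ hf hk n
  intro z
  have hprob : IsProbabilityMeasure ((limitLaw g p μ t).map (shift z)) :=
    Measure.isProbabilityMeasure_map (measurable_shift z).aemeasurable
  have heq := eq_of_isTest (M := ⟨_, hprob⟩) (M' := ⟨_, hconv.isProbabilityMeasure⟩)
    fun f hf => ?_
  · exact congrArg Subtype.val heq
  · change ∫ η, f η ∂(limitLaw g p μ t).map (shift z) = ∫ η, f η ∂limitLaw g p μ t
    rw [integral_map (measurable_shift z).aemeasurable hf.measurable.aestronglyMeasurable]
    refine le_antisymm (hle f z hf) ?_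
    have hinv : ∀ η : Config d, shift z (shift (-z) η) = η := fun η => funext fun x => by
      simp [shift_apply]
    simpa only [hinv] using hle _ (-z) (hf.comp_shift z)

lemma lintegral_apply_limitLaw_le (h : IsZeroRange g p) (ht : 0 ≤ t) [IsProbabilityMeasure μ]
    (hμ : TranslationInvariant μ) (hmean : ∫⁻ η, (η 0 : ℝ≥0∞) ∂μ < ∞) :
    ∫⁻ η, (η 0 : ℝ≥0∞) ∂limitLaw g p μ t ≤ ∫⁻ η, (η 0 : ℝ≥0∞) ∂μ := by
  have hconv := weaklyConverges_limitLaw h ht hμ hmean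
  have := hconv.isProbabilityMeasure
  have hprob := isProbabilityMeasure_evolve_boxLaw h ht (μ := μ)
  refine lintegral_apply_le_of_min fun K => ?_
  have hf : IsTest fun η : Config d => ((min (η 0) K : ℕ) : ℝ) := isTest_min 0 K
  rw [← hf.ofReal_integral]
  refine le_of_tendsto' (ENNReal.tendsto_ofReal (hconv.tendsto_integral hf)) fun n => ?_
  rw [hf.ofReal_integral]
  refine (lintegral_mono fun ξ => ?_).trans
    (lintegral_apply_evolve_boxLaw_le h ht hμ hmean n 0)
  rw [ENNReal.ofReal_natCast]
  exact Nat.cast_le.2 (min_le_left _ _)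

/-! ### Other increasing approximations -/

lemma aestronglyMeasurable_of_finiteConfigs (hν : ν (finiteConfigs d)ᶜ = 0) (F : Config d → ℝ) :
    AEStronglyMeasurable F ν := by
  have : ν.restrict (finiteConfigs d) = ν := Measure.restrict_eq_self_of_ae_mem hν
  rw [← this]
  refine aestronglyMeasurable_of_tendsto_ae atTop
    (fun n => (measurable_comp_boxConfig n F).aestronglyMeasurable) ?_
  filter_upwards [ae_restrict_mem measurableSet_finiteConfigs] with η hη
  exact tendsto_const_nhds.congr' ((eventually_boxConfig_eq hη).mono fun _ hn =>
    congrArg _ hn.symm)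

lemma integral_evolve (h : IsZeroRange g p) (ht : 0 ≤ t) [IsProbabilityMeasure ν]
    (hν : ν (finiteConfigs d)ᶜ = 0) (hf : IsTest f) :
    ∫ ξ, f ξ ∂evolve g p t ν = ∫ η, semigroup g p t f η ∂ν := by
  have hae : ∀ᵐ η ∂ν, η ∈ finiteConfigs d := hν
  rw [integral_eq_lintegral_of_nonneg_ae (.of_forall hf.nonneg)
    hf.measurable.aestronglyMeasurable, integral_eq_lintegral_of_nonneg_ae
    (hae.mono fun η hη => semigroup_nonneg_of_isTest h ht hf hη)
    (aestronglyMeasurable_of_finiteConfigs hν _),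
    lintegral_ofReal_evolve h ht hν hf.finiteBounded fun η _ => hf.nonneg η]

/-- Every increasing sequence of laws on finite configurations with the limit `μ` leads to the
same limit at time `t`. Cutting a finite configuration off outside of a large box does not change
it, so that the laws at time `t` lie below those of the box approximations; and `S(t) f([·]_m)` is
local and below `S(t) f`, so that in the limit they lie above them. -/
lemma weaklyConverges_evolve (h : IsZeroRange g p) (ht : 0 ≤ t) [IsProbabilityMeasure μ]
    (hμ : TranslationInvariant μ) (hmean : ∫⁻ η, (η 0 : ℝ≥0∞) ∂μ < ∞)
    {ν : ℕ → Measure (Config d)} (hνprob : ∀ n, IsProbabilityMeasure (ν n))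
    (hνfin : ∀ n, ν n (finiteConfigs d)ᶜ = 0) (hνmono : ∀ n, StochLE (ν n) (ν (n + 1)))
    (hνlim : WeaklyConverges ν μ) :
    WeaklyConverges (fun n => evolve g p t (ν n)) (limitLaw g p μ t) := by
  have hconv := weaklyConverges_limitLaw h ht hμ hmean
  have := hconv.isProbabilityMeasure
  refine weaklyConverges_of_isTest (fun n => isProbabilityMeasure_evolve h ht (hνfin n))
    fun f hf => ?_
  have hae : ∀ n, ∀ᵐ η ∂ν n, η ∈ finiteConfigs d := hνfin
  have hF := fun m => hf.semigroup_boxConfig h ht m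
  obtain ⟨C, hC⟩ := semigroup_finiteBounded h ht hf.finiteBounded
  have hFint : ∀ n, Integrable (semigroup g p t f) (ν n) := fun n =>
    Integrable.of_bound (aestronglyMeasurable_of_finiteConfigs (hνfin n) _) C
      ((hae n).mono fun η hη => hC η hη)
  have hbox : Tendsto (fun m => ∫ η, semigroup g p t f (boxConfig m η) ∂μ) atTop
      (𝓝 (∫ η, f η ∂limitLaw g p μ t)) := by
    simpa only [integral_evolve_boxLaw h ht hf] using hconv.tendsto_integral hf
  have hboxle : ∀ m, ∫ η, semigroup g p t f (boxConfig m η) ∂μ ≤ ∫ η, f η ∂limitLaw g p μ t :=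
    Monotone.ge_of_tendsto (monotone_nat_of_le_succ fun m => by
      simpa only [integral_evolve_boxLaw h ht hf] using
        (stochLE_evolve_boxLaw h ht hμ m).integral_le hf) hbox
  have hνle : ∀ m n, ∫ η, semigroup g p t f (boxConfig m η) ∂ν n ≤
      ∫ η, semigroup g p t f (boxConfig m η) ∂μ := fun m =>
    Monotone.ge_of_tendsto (monotone_nat_of_le_succ fun n => (hνmono n).integral_le (hF m))
      (hνlim.tendsto_integral (hF m))
  simp only [fun n => integral_evolve h ht (hνfin n) hf]
  have hupper : ∀ n, ∫ η, semigroup g p t f η ∂ν n ≤ ∫ η, f η ∂limitLaw g p μ t := fun n => by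
    refine le_of_tendsto' (tendsto_integral_of_dominated_convergence (fun _ => C)
      (fun m => (hF m).measurable.aestronglyMeasurable) (integrable_const C)
      (fun m => .of_forall fun η => hC _ (boxConfig_mem m η)) ?_)
      fun m => (hνle m n).trans (hboxle m)
    filter_upwards [hae n] with η hη
    exact tendsto_const_nhds.congr' ((eventually_boxConfig_eq hη).mono fun _ hm =>
      congrArg _ hm.symm)
  have hlower : ∀ m n, ∫ η, semigroup g p t f (boxConfig m η) ∂ν n ≤
      ∫ η, semigroup g p t f η ∂ν n := fun m n =>
    integral_mono_ae ((hF m).integrable _) (hFint n) ((hae n).mono fun η hη =>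
      semigroup_monotoneOn h ht hf.finiteBounded (hf.mono.monotoneOn _) (boxConfig_mem m η) hη
        (boxConfig_le m η))
  refine tendsto_order.2 ⟨fun c hc => ?_, fun c hc => .of_forall fun n => (hupper n).trans_lt hc⟩
  obtain ⟨m, hm⟩ := ((tendsto_order.1 hbox).1 c hc).exists
  filter_upwards [(tendsto_order.1 (hνlim.tendsto_integral (hF m))).1 c hm] with n hn
  exact hn.trans_le (hlower m n)

/-- The laws `[μ]_n S(t)` increase to `μ_t`, and their evolution by time `s` leads both to
`μ_{t+s}` and, by `weaklyConverges_evolve`, to `(μ_t)_s`. -/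
lemma limitLaw_add (h : IsZeroRange g p) (ht : 0 ≤ t) (hs : 0 ≤ s) [IsProbabilityMeasure μ]
    (hμ : TranslationInvariant μ) (hmean : ∫⁻ η, (η 0 : ℝ≥0∞) ∂μ < ∞) :
    limitLaw g p μ (t + s) = limitLaw g p (limitLaw g p μ t) s := by
  have hconv := weaklyConverges_limitLaw h ht hμ hmean
  have := hconv.isProbabilityMeasure
  have h1 := weaklyConverges_evolve h hs (translationInvariant_limitLaw h ht hμ hmean)
    ((lintegral_apply_limitLaw_le h ht hμ hmean).trans_lt hmean)
    (isProbabilityMeasure_evolve_boxLaw h ht) (fun n => evolve_compl_finiteConfigs _ _)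
    (stochLE_evolve_boxLaw h ht hμ) hconv
  simp only [evolve_evolve h ht hs (boxLaw_compl_finiteConfigs _ μ)] at h1
  exact (weaklyConverges_limitLaw h (add_nonneg ht hs) hμ hmean).unique h1

end ZeroRange

theorem proposition2p1 {d : ℕ} (g : ℕ → ℝ) (hg_zero : g 0 = 0) (hg_mono : Monotone g)
    (hg_lim : Tendsto g atTop atTop)
    (p : ZeroRange.Site d → ZeroRange.Site d → ℝ)
    (hp : ZeroRange.IsTranslationInvariantTransition p)
    (μ : Measure (ZeroRange.Config d)) (hμ_prob : IsProbabilityMeasure μ)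
    (hμ_inv : ZeroRange.TranslationInvariant μ)
    (hμ_mean : ∫⁻ η, (η 0 : ℝ≥0∞) ∂μ < ∞) :
    (∀ t : ℝ, 0 ≤ t →
      -- the laws `[μ]_n S(t)` increase and converge weakly to a probability measure `μ_t`
      (∀ n : ℕ, ZeroRange.StochLE (ZeroRange.evolve g p t (ZeroRange.boxLaw n μ))
        (ZeroRange.evolve g p t (ZeroRange.boxLaw (n + 1) μ))) ∧
      ZeroRange.WeaklyConverges (fun n => ZeroRange.evolve g p t (ZeroRange.boxLaw n μ))
        (ZeroRange.limitLaw g p μ t) ∧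
      -- i) translation invariance
      ZeroRange.TranslationInvariant (ZeroRange.limitLaw g p μ t) ∧
      -- ii) the mean does not increase
      ∫⁻ η, (η 0 : ℝ≥0∞) ∂(ZeroRange.limitLaw g p μ t) ≤ ∫⁻ η, (η 0 : ℝ≥0∞) ∂μ ∧
      -- iv) any increasing approximation by laws on finite configurations has the same limit
      (∀ ν : ℕ → Measure (ZeroRange.Config d),
        (∀ n, IsProbabilityMeasure (ν n)) →
        (∀ n, ν n (ZeroRange.finiteConfigs d)ᶜ = 0) →
        (∀ n, ZeroRange.StochLE (ν n) (ν (n + 1))) →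
        ZeroRange.WeaklyConverges ν μ →
        ZeroRange.WeaklyConverges (fun n => ZeroRange.evolve g p t (ν n))
          (ZeroRange.limitLaw g p μ t))) ∧
    -- iii) the semigroup property
    (∀ t s : ℝ, 0 ≤ t → 0 ≤ s →
      ZeroRange.limitLaw g p μ (t + s) =
        ZeroRange.limitLaw g p (ZeroRange.limitLaw g p μ t) s) := by
  have h : ZeroRange.IsZeroRange g p := ⟨hg_zero, hg_mono, hp⟩
  exact ⟨fun t ht => ⟨ZeroRange.stochLE_evolve_boxLaw h ht hμ_inv,
    ZeroRange.weaklyConverges_limitLaw h ht hμ_inv hμ_mean,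
    ZeroRange.translationInvariant_limitLaw h ht hμ_inv hμ_mean,
    ZeroRange.lintegral_apply_limitLaw_le h ht hμ_inv hμ_mean,
    fun _ => ZeroRange.weaklyConverges_evolve h ht hμ_inv hμ_mean⟩,
    fun _ _ ht hs => ZeroRange.limitLaw_add h ht hs hμ_inv hμ_mean⟩
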